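/- **Conventions.** Inner products on Hilbert $C^*$-modules are linear in the second variable, and a Hilbert $\mathcal B$-module $E$ is *full* if the closed linear span of $\{\langle x,y\rangle : x,y\in E\}$ is $\mathcal B$. $\mathcal B^a(E)$ is the $*$-algebra of adjointable operators on $E$, $\mathcal U$ denotes unitary groups, and $\mathcal B(\mathcal B,\mathcal C)$ denotes the bounded linear maps $\mathcal B\to\mathcal C$. A *$C^*$-correspondence* from $\mathcal A$ to $\mathcal B$ is a Hilbert $\mathcal B$-module together with a $*$-homomorphism (the left action) from $\mathcal A$ into its adjointable operators. The interior tensor product $E\odot\mathcal F$ of a Hilbert $\mathcal B$-module $E$ with a $C^*$-correspondence $\mathcal F$ from $\mathcal B$ to $\mathcal C$ is the Hilbert $\mathcal C$-module obtained by separation and completion from the algebraic tensor product with $\langle x\odot f,x'\odot f'\rangle=\langle f,\langle x,x'\rangle f'\rangle$. An *isometry* between Hilbert $\mathcal C$-modules is a map that preserves inner products. A *unitary representation* of a topological group $G$ in the unitary group of a unital $C^*$-algebra is a norm-continuous homomorphism; in $\mathcal U\mathcal B^a(X)$, for a Hilbert module $X$, it is a homomorphism $v$ such that $t\mapsto v_tf$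 is continuous for every $f\in X$. A *dynamical system* $(G,\eta,E)$ on a full Hilbert $\mathcal B$-module $E$ is a homomorphism $t\mapsto\eta_t$ from $G$ to the group of bijections $\Psi$ of $E$ for which $\Psi$ and $\Psi^{-1}$ are morphisms of Hilbert modules (i.e. $\langle\Psi x,\Psi y\rangle=\psi(\langle x,y\rangle)$ for some $*$-homomorphism $\psi$ of $\mathcal B$), such that $t\mapsto\eta_t(x)$ is continuous for every $x\in E$; then $\alpha^\eta_t$ denotes the unique $*$-homomorphism of $\mathcal B$ with $\alpha^\eta_t(\langle x,y\rangle)=\langle\eta_t(x),\eta_t(y)\rangle$ for all $x,y\in E$. A map $\mathfrak K:S\times S\to\mathcal B(\mathcal B,\mathcal C)$ is a *CPD-kernel* if $\sum_{i,j}c_i^*\,\mathfrak K^{\sigma_i,\sigma_j}(b_i^*b_j)\,c_j\ge 0$ for all finite choices of $\sigma_i\in S$, $b_i\in\mathcal B$, $c_i\in\mathcal C$. A family of maps $\mathcal K^\sigma:E\to F$ $(\sigma\in S)$ is a *$\mathfrak K$-family* if $\langle\mathcal K^\sigma(x),\mathcal K^{\sigma'}(x')\rangle=\mathfrak K^{\sigma,\sigma'}(\langle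 x,x'\rangle)$ for all $x,x'\in E$ and $\sigma,\sigma'\in S$. It is *$(u',u)$-covariant* with respect to $(G,\eta,E)$ if $\mathcal K^\sigma(\eta_t(x))=u'_t\,\mathcal K^\sigma(x)\,u_t^*$ for all $t\in G$, $\sigma\in S$, $x\in E$. **Theorem.** Let $u:G\to\mathcal U\mathcal C$ and $u':G\to\mathcal U\mathcal D$ be unitary representations of a locally compact group $G$ on unital $C^*$-algebras $\mathcal C$ and $\mathcal D$. Let $E$ be a full Hilbert $C^*$-module over a unital $C^*$-algebra $\mathcal B$, let $F$ be a $C^*$-correspondence from $\mathcal D$ to $\mathcal C$, let $S$ be a set, and let $\mathcal K^\sigma:E\to F$ be a map for each $\sigma\in S$. If $(G,\eta,E)$ is a dynamical system on $E$, then the following are equivalent: (i) There is a CPD-kernel $\mathfrak K:S\times S\to\mathcal B(\mathcal B,\mathcal C)$ such that $\{\mathcal K^\sigma\}_{\sigma\in S}$ is a $(u',u)$-covariant $\mathfrak K$-family with respect to $(G,\eta,E)$. (ii) There exist a $C^*$-correspondence $\mathcal F$ from $\mathcal B$ to $\mathcal C$ with left action $\pi:\mathcal B\to\mathcal B^a(\mathcal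 F)$, a map $\mathfrak i:S\to\mathcal F$, an isometry $\nu:E\odot\mathcal F\to F$ with $\nu(x\odot\mathfrak i(\sigma))=\mathcal K^\sigma(x)$ for all $x\in E$ and $\sigma\in S$, and unitary representations $v:G\to\mathcal U\mathcal B^a(\mathcal F)$ and $w':G\to\mathcal U\mathcal B^a(E\odot\mathcal F)$ such that (a) $\pi(\alpha^\eta_t(b))=v_t\,\pi(b)\,v_t^*$ for all $b\in\mathcal B$, $t\in G$; (b) $v_t\,\mathfrak i(\sigma)=\mathfrak i(\sigma)\,u_t$ for all $t\in G$, $\sigma\in S$; (c) $w'_t(x\odot b\,\mathfrak i(\sigma)\,c)=\eta_t(x)\odot v_t(b\,\mathfrak i(\sigma)\,c)$ for all $b\in\mathcal B$, $c\in\mathcal C$, $x\in E$, $\sigma\in S$, $t\in G$; (d) $\nu\,w'_t=u'_t\,\nu$ for all $t\in G$. -/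

import Mathlib

open scoped TensorProduct

noncomputable section

namespace HilbertModule

/-! ### Right Hilbert modules

A (right) Hilbert `C⋆`-module over `B` is a complete `CStarModule` over `Bᵐᵒᵖ`. Mathlib's axiom
`inner x (a • y) = a * inner x y`, read in `Bᵐᵒᵖ`, is `⟨x, y b⟩ = ⟨x, y⟩ b`, where `y b` is
`MulOpposite.op b • y`. -/

section Basic

variable (B : Type*) {E : Type*} [CStarAlgebra B] [PartialOrder B]
  [NormedAddCommGroup E] [NormedSpace ℂ E] [Module Bᵐᵒᵖ E] [CStarModule Bᵐᵒᵖ E]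

/-- The `B`-valued inner product `⟨x, y⟩` of a right Hilbert `B`-module. -/
def ip (x y : E) : B := (inner Bᵐᵒᵖ x y).unop

theorem ip_add_right (x y z : E) : ip B x (y + z) = ip B x y + ip B x z := by simp [ip]

theorem ip_add_left (x y z : E) : ip B (x + y) z = ip B x z + ip B y z := by simp [ip]

theorem ip_smul_right (a : ℂ) (x y : E) : ip B x (a • y) = a • ip B x y := by simp [ip]

theorem ip_smul_left (a : ℂ) (x y : E) : ip B (a • x) y = star a • ip B x y := by simp [ip]

theorem ip_zero_right (x : E) : ip B x 0 = 0 := by simp [ip]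

theorem ip_zero_left (x : E) : ip B 0 x = 0 := by simp [ip]

theorem ip_neg_right (x y : E) : ip B x (-y) = -ip B x y := by simp [ip]

theorem ip_neg_left (x y : E) : ip B (-x) y = -ip B x y := by simp [ip]

theorem ip_sub_right (x y z : E) : ip B x (y - z) = ip B x y - ip B x z := by simp [ip]

theorem ip_sub_left (x y z : E) : ip B (x - y) z = ip B x z - ip B y z := by simp [ip]

theorem star_ip (x y : E) : star (ip B x y) = ip B y x := by
  rw [ip, ← MulOpposite.unop_star, CStarModule.star_inner, ip]

theorem ip_op_smul_right (b : B) (x y : E) :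
    ip B x (MulOpposite.op b • y) = ip B x y * b := by simp [ip]

theorem ip_op_smul_left (b : B) (x y : E) :
    ip B (MulOpposite.op b • x) y = star b * ip B x y := by simp [ip]

theorem ip_self_nonneg (x : E) : 0 ≤ ip B x x :=
  MulOpposite.unop_nonneg.2 (CStarModule.inner_self_nonneg (A := Bᵐᵒᵖ) (x := x))

theorem ip_self_eq_zero {x : E} : ip B x x = 0 ↔ x = 0 := by
  rw [ip, MulOpposite.unop_eq_zero_iff, CStarModule.inner_self]

variable {B} in
theorem ext_ip {x y : E} (h : ∀ z : E, ip B z x = ip B z y) : x = y := by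
  rw [← sub_eq_zero, ← ip_self_eq_zero B, ip_sub_right, h, sub_self]

theorem ip_sum_right {ι : Type*} (s : Finset ι) (x : E) (f : ι → E) :
    ip B x (∑ i ∈ s, f i) = ∑ i ∈ s, ip B x (f i) := by simp [ip]

theorem ip_sum_left {ι : Type*} (s : Finset ι) (x : E) (f : ι → E) :
    ip B (∑ i ∈ s, f i) x = ∑ i ∈ s, ip B (f i) x := by simp [ip]

variable (E) in
/-- `E` is full: the closed linear span of all inner products is `B`. -/
def IsFull : Prop :=
  Dense (Submodule.span ℂ {b : B | ∃ x y : E, b = ip B x y} : Set B)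

end Basic

/-! ### Adjointable operators -/

section Adjointable

variable (C F : Type*) [CStarAlgebra C] [PartialOrder C]
  [NormedAddCommGroup F] [NormedSpace ℂ F] [Module Cᵐᵒᵖ F] [CStarModule Cᵐᵒᵖ F]

/-- The adjointable maps `F → F`: maps that have an adjoint. The adjoint is unique, and
adjointable maps are automatically `C`-linear. -/
structure Adjointable where
  toFun : F → F
  adj : F → F
  ip_toFun : ∀ x y : F, ip C (toFun x) y = ip C x (adj y)

variable {C F}

namespace Adjointable

instance : CoeFun (Adjointable C F) (fun _ => F → F) := ⟨Adjointable.toFun⟩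

theorem ip_adj (T : Adjointable C F) (x y : F) : ip C (T.adj x) y = ip C x (T y) := by
  rw [← star_ip, ← T.ip_toFun, star_ip]

theorem ip_map (T : Adjointable C F) (x y : F) : ip C x (T y) = ip C (T.adj x) y :=
  (T.ip_adj x y).symm

@[ext]
theorem ext {S T : Adjointable C F} (h : ∀ x, S x = T x) : S = T := by
  obtain ⟨f, f', hf⟩ := S
  obtain ⟨g, g', hg⟩ := T
  obtain rfl : f = g := funext h
  obtain rfl : f' = g' := funext fun y => ext_ip (B := C) fun z => by rw [← hf, hg]
  rfl

theorem map_add (T : Adjointable C F) (x y : F) : T (x + y) = T x + T y :=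
  ext_ip (B := C) fun z => by simp only [ip_map, ip_add_right]

theorem map_smul (T : Adjointable C F) (a : ℂ) (x : F) : T (a • x) = a • T x :=
  ext_ip (B := C) fun z => by simp only [ip_map, ip_smul_right]

theorem map_op_smul (T : Adjointable C F) (c : C) (x : F) :
    T (MulOpposite.op c • x) = MulOpposite.op c • T x :=
  ext_ip (B := C) fun z => by simp only [ip_map, ip_op_smul_right]

instance : Zero (Adjointable C F) := ⟨⟨fun _ => 0, fun _ => 0, fun x y => by
  rw [ip_zero_left, ip_zero_right]⟩⟩

instance : One (Adjointable C F) := ⟨⟨fun x => x, fun x => x, fun _ _ => rfl⟩⟩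

instance : Add (Adjointable C F) := ⟨fun S T => ⟨fun x => S x + T x, fun x => S.adj x + T.adj x,
  fun x y => by rw [ip_add_left, ip_add_right, S.ip_toFun, T.ip_toFun]⟩⟩

instance : Neg (Adjointable C F) := ⟨fun S => ⟨fun x => -S x, fun x => -S.adj x,
  fun x y => by rw [ip_neg_left, ip_neg_right, S.ip_toFun]⟩⟩

/-- Multiplication of operators is composition. -/
instance : Mul (Adjointable C F) := ⟨fun S T => ⟨fun x => S (T x), fun x => T.adj (S.adj x),
  fun x y => by rw [S.ip_toFun, T.ip_toFun]⟩⟩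

instance : SMul ℂ (Adjointable C F) := ⟨fun a S => ⟨fun x => a • S x, fun x => star a • S.adj x,
  fun x y => by rw [ip_smul_left, ip_smul_right, S.ip_toFun]⟩⟩

/-- The involution is the adjoint. -/
instance : Star (Adjointable C F) := ⟨fun S => ⟨S.adj, S, fun x y => S.ip_adj x y⟩⟩

@[simp] theorem zero_apply (x : F) : (0 : Adjointable C F) x = 0 := rfl
@[simp] theorem one_apply (x : F) : (1 : Adjointable C F) x = x := rfl
@[simp] theorem add_apply (S T : Adjointable C F) (x : F) : (S + T) x = S x + T x := rfl
@[simp] theorem neg_apply (S : Adjointable C F) (x : F) : (-S) x = -S x := rfl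
@[simp] theorem mul_apply (S T : Adjointable C F) (x : F) : (S * T) x = S (T x) := rfl
@[simp] theorem smul_apply (a : ℂ) (S : Adjointable C F) (x : F) : (a • S) x = a • S x := rfl
@[simp] theorem star_apply (S : Adjointable C F) (x : F) : (star S) x = S.adj x := rfl

theorem map_zero (T : Adjointable C F) : T 0 = 0 := by
  simpa using T.map_smul 0 0

instance : Ring (Adjointable C F) where
  add_assoc _ _ _ := by ext; simp [add_assoc]
  zero_add _ := by ext; simp
  add_zero _ := by ext; simp
  add_comm _ _ := by ext; simp [add_comm]
  nsmul := nsmulRec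
  zsmul := zsmulRec
  neg_add_cancel _ := by ext; simp
  mul_assoc _ _ _ := by ext; simp
  one_mul _ := by ext; simp
  mul_one _ := by ext; simp
  zero_mul _ := by ext; simp
  mul_zero T := by ext; simp [T.map_zero]
  left_distrib S _ _ := by ext; simp [S.map_add]
  right_distrib _ _ _ := by ext; simp

theorem sum_apply {ι : Type*} (s : Finset ι) (f : ι → Adjointable C F) (x : F) :
    (∑ i ∈ s, f i) x = ∑ i ∈ s, f i x := by
  classical
  induction s using Finset.induction_on with
  | empty => simp
  | insert i s hi ih => rw [Finset.sum_insert hi, Finset.sum_insert hi, add_apply, ih]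

instance : Module ℂ (Adjointable C F) where
  one_smul _ := by ext; simp
  mul_smul _ _ _ := by ext; simp [mul_smul]
  smul_zero _ := by ext; simp
  smul_add _ _ _ := by ext; simp
  add_smul _ _ _ := by ext; simp [add_smul]
  zero_smul _ := by ext; simp

instance : Algebra ℂ (Adjointable C F) :=
  Algebra.ofModule (fun _ _ _ => by ext; simp) (fun _ S _ => by ext; simp [S.map_smul])

instance : StarRing (Adjointable C F) where
  star_involutive _ := rfl
  star_mul _ _ := rfl
  star_add _ _ := rfl

instance : StarModule ℂ (Adjointable C F) where
  star_smul _ _ := Adjointable.ext fun _ => rfl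

end Adjointable

end Adjointable

/-! ### Separation and completion of a semi-inner product module -/

section Completion

/-- A `C`-valued semi-inner product on a complex vector space `V` with a right multiplication
`act c v = v c` by the elements of `C`. -/
structure SemiInner (C V : Type*) [CStarAlgebra C] [PartialOrder C]
    [AddCommGroup V] [Module ℂ V] where
  form : V →ₗ⋆[ℂ] V →ₗ[ℂ] C
  star_form : ∀ v w, star (form v w) = form w v
  form_self_nonneg : ∀ v, 0 ≤ form v v
  act : C → V → V
  form_act : ∀ c v w, form v (act c w) = form v w * c

variable {C V : Type*} [CStarAlgebra C] [PartialOrder C] [AddCommGroup V] [Module ℂ V]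

namespace SemiInner

theorem act_form (h : SemiInner C V) (c : C) (v w : V) :
    h.form (h.act c v) w = star c * h.form v w := by
  rw [← h.star_form, h.form_act, star_mul, h.star_form]

/-- Vectors of length zero are orthogonal to everything. -/
theorem form_eq_zero [StarOrderedRing C] (h : SemiInner C V) {v : V} (hv : h.form v v = 0) : h.form v = 0 := by
  ext w
  set a : C := h.form v w with ha
  have ha' : h.form w v = star a := by rw [ha, h.star_form]
  have key : ∀ r : ℝ, (2 * r) • (star a * a) ≤ h.form w w := by
    intro r
    have := h.form_self_nonneg (w - (r : ℂ) • h.act a v)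
    simp only [map_sub, LinearMap.map_smulₛₗ, LinearMap.sub_apply, LinearMap.smul_apply,
      h.form_act, h.act_form, hv, ha', ← ha, zero_mul, mul_zero, smul_zero, map_smul, sub_zero,
      Complex.conj_ofReal] at this
    have h2 : (2 * r) • (star a * a) = (r : ℂ) • (star a * a) + (r : ℂ) • (star a * a) := by
      rw [two_mul, add_smul]; rfl
    rw [h2, ← sub_nonneg]
    convert this using 1
    abel
  have hn : ∀ r : ℝ, 0 ≤ r → 2 * r * ‖star a * a‖ ≤ ‖h.form w w‖ := by
    intro r hr
    have := CStarAlgebra.norm_le_norm_of_nonneg_of_le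
      (smul_nonneg (by positivity : 0 ≤ 2 * r) (star_mul_self_nonneg a)) (key r)
    rwa [norm_smul, Real.norm_of_nonneg (by positivity)] at this
  have : ‖star a * a‖ = 0 := by
    by_contra hne
    have hpos : 0 < ‖star a * a‖ := lt_of_le_of_ne (norm_nonneg _) (Ne.symm hne)
    have := hn ((‖h.form w w‖ + 1) / ‖star a * a‖) (by positivity)
    have e : 2 * ((‖h.form w w‖ + 1) / ‖star a * a‖) * ‖star a * a‖
        = 2 * (‖h.form w w‖ + 1) := by field_simp
    rw [e] at this
    linarith [norm_nonneg (h.form w w)]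
  rwa [norm_eq_zero, CStarRing.star_mul_self_eq_zero_iff] at this

/-- The quotient of `V` by the vectors of length zero. -/
def Sep (h : SemiInner C V) : Type _ := V ⧸ LinearMap.ker h.form

namespace Sep

variable (h : SemiInner C V)

instance : AddCommGroup h.Sep := inferInstanceAs (AddCommGroup (V ⧸ LinearMap.ker h.form))

instance : Module ℂ h.Sep := inferInstanceAs (Module ℂ (V ⧸ LinearMap.ker h.form))

/-- The quotient map. -/
def mk : V →ₗ[ℂ] h.Sep := (LinearMap.ker h.form).mkQ

theorem mk_surjective : Function.Surjective (mk h) := Submodule.mkQ_surjective _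

variable {h} in
theorem mk_eq_mk {v w : V} : mk h v = mk h w ↔ ∀ u, h.form u v = h.form u w := by
  rw [← sub_eq_zero, ← map_sub]
  change (Submodule.Quotient.mk (v - w) : V ⧸ LinearMap.ker h.form) = 0 ↔ _
  rw [Submodule.Quotient.mk_eq_zero, LinearMap.mem_ker]
  constructor
  · intro H u
    have := LinearMap.congr_fun H u
    rw [← sub_eq_zero, ← map_sub, ← h.star_form, this, LinearMap.zero_apply, star_zero]
  · intro H
    ext u
    rw [← h.star_form, map_sub, H, sub_self, LinearMap.zero_apply, star_zero]

instance : Inner Cᵐᵒᵖ h.Sep where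
  inner := fun x y => Quotient.liftOn₂' x y (fun v w => MulOpposite.op (h.form v w)) (by
    intro v w v' w' hv hw
    have hv' : mk h v = mk h v' := Quotient.sound' hv
    have hw' : mk h w = mk h w' := Quotient.sound' hw
    rw [mk_eq_mk] at hv' hw'
    rw [hw', ← h.star_form, hv', h.star_form])

theorem inner_mk (v w : V) : inner Cᵐᵒᵖ (mk h v) (mk h w) = MulOpposite.op (h.form v w) := rfl

instance : SMul Cᵐᵒᵖ h.Sep where
  smul := fun c x => Quotient.liftOn' x (fun v => mk h (h.act c.unop v)) (by
    intro v w hv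
    have hv' : mk h v = mk h w := Quotient.sound' hv
    rw [mk_eq_mk] at hv' ⊢
    intro u
    rw [h.form_act, h.form_act, hv'])

theorem op_smul_mk (c : C) (v : V) : MulOpposite.op c • mk h v = mk h (h.act c v) := rfl

instance : Module Cᵐᵒᵖ h.Sep where
  one_smul x := by
    obtain ⟨v, rfl⟩ := mk_surjective h x
    rw [← MulOpposite.op_one, op_smul_mk, mk_eq_mk]
    simp [h.form_act]
  mul_smul c d x := by
    obtain ⟨v, rfl⟩ := mk_surjective h x
    induction c with | _ c
    induction d with | _ d
    rw [← MulOpposite.op_mul, op_smul_mk, op_smul_mk, op_smul_mk, mk_eq_mk]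
    simp [h.form_act, mul_assoc]
  smul_zero c := by
    induction c with | _ c
    rw [← map_zero (mk h), op_smul_mk, mk_eq_mk]
    simp [h.form_act]
  smul_add c x y := by
    obtain ⟨v, rfl⟩ := mk_surjective h x
    obtain ⟨w, rfl⟩ := mk_surjective h y
    induction c with | _ c
    rw [← map_add, op_smul_mk, op_smul_mk, op_smul_mk, ← map_add, mk_eq_mk]
    simp [h.form_act, add_mul]
  add_smul c d x := by
    obtain ⟨v, rfl⟩ := mk_surjective h x
    induction c with | _ c
    induction d with | _ d
    rw [← MulOpposite.op_add, op_smul_mk, op_smul_mk, op_smul_mk, ← map_add, mk_eq_mk]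
    simp [h.form_act, mul_add]
  zero_smul x := by
    obtain ⟨v, rfl⟩ := mk_surjective h x
    rw [← MulOpposite.op_zero, op_smul_mk, ← map_zero (mk h), mk_eq_mk]
    simp [h.form_act]

variable [StarOrderedRing C]

/-- The norm of a Hilbert module, `‖x‖ = ‖⟨x, x⟩‖ ^ (1 / 2)`. -/
instance : Norm h.Sep := CStarModule.norm Cᵐᵒᵖ

instance : CStarModule Cᵐᵒᵖ h.Sep where
  inner_add_right {x y z} := by
    obtain ⟨u, rfl⟩ := mk_surjective h x
    obtain ⟨v, rfl⟩ := mk_surjective h y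
    obtain ⟨w, rfl⟩ := mk_surjective h z
    rw [← map_add, inner_mk, inner_mk, inner_mk, map_add, MulOpposite.op_add]
  inner_self_nonneg {x} := by
    obtain ⟨u, rfl⟩ := mk_surjective h x
    exact MulOpposite.op_nonneg.2 (h.form_self_nonneg u)
  inner_self {x} := by
    obtain ⟨u, rfl⟩ := mk_surjective h x
    rw [inner_mk, MulOpposite.op_eq_zero_iff]
    constructor
    · intro H
      rw [← map_zero (mk h), mk_eq_mk]
      intro v
      rw [← h.star_form, h.form_eq_zero H]
      simp
    · intro H
      rw [← map_zero (mk h), mk_eq_mk] at H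
      simpa using H u
  inner_op_smul_right {c x y} := by
    obtain ⟨u, rfl⟩ := mk_surjective h x
    obtain ⟨v, rfl⟩ := mk_surjective h y
    induction c with | _ c
    rw [op_smul_mk, inner_mk, inner_mk, h.form_act, MulOpposite.op_mul]
  inner_smul_right_complex {a x y} := by
    obtain ⟨u, rfl⟩ := mk_surjective h x
    obtain ⟨v, rfl⟩ := mk_surjective h y
    rw [← map_smul, inner_mk, inner_mk, map_smul, MulOpposite.op_smul]
  star_inner x y := by
    obtain ⟨u, rfl⟩ := mk_surjective h x
    obtain ⟨v, rfl⟩ := mk_surjective h y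
    rw [inner_mk, inner_mk, ← MulOpposite.op_star, h.star_form]
  norm_eq_sqrt_norm_inner_self _ := rfl

instance : NormedAddCommGroup h.Sep := CStarModule.normedAddCommGroup Cᵐᵒᵖ

instance : NormedSpace ℂ h.Sep := .ofCore (CStarModule.normedSpaceCore Cᵐᵒᵖ)

end Sep

end SemiInner

/-- Right multiplication by `c` on a Hilbert module is bounded by `‖c‖`. -/
theorem norm_op_smul_le {X : Type*} [NormedAddCommGroup X] [NormedSpace ℂ X] [Module Cᵐᵒᵖ X]
    [CStarModule Cᵐᵒᵖ X] (c : Cᵐᵒᵖ) (x : X) : ‖c • x‖ ≤ ‖c‖ * ‖x‖ := by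
  refine le_of_sq_le_sq ?_ (by positivity)
  rw [CStarModule.norm_sq_eq Cᵐᵒᵖ, mul_pow, CStarModule.norm_sq_eq Cᵐᵒᵖ (x := x),
    CStarModule.inner_op_smul_right, CStarModule.inner_op_smul_left, ← mul_assoc]
  calc ‖c * inner Cᵐᵒᵖ x x * star c‖ ≤ ‖c‖ * ‖inner Cᵐᵒᵖ x x‖ * ‖star c‖ := norm_mul₃_le
    _ = _ := by rw [norm_star]; ring

namespace SemiInner

variable [StarOrderedRing C]

instance (h : SemiInner C V) : UniformContinuousConstSMul Cᵐᵒᵖ h.Sep where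
  uniformContinuous_const_smul c :=
    (AddMonoidHomClass.lipschitz_of_bound (DistribSMul.toAddMonoidHom h.Sep c) ‖c‖
      (norm_op_smul_le c)).uniformContinuous

/-- The Hilbert `C`-module obtained from a semi-inner product by dividing out the vectors of length
zero and completing. -/
def Hilb (h : SemiInner C V) : Type _ := UniformSpace.Completion h.Sep

namespace Hilb

variable (h : SemiInner C V)

instance : NormedAddCommGroup h.Hilb :=
  inferInstanceAs (NormedAddCommGroup (UniformSpace.Completion h.Sep))

instance : NormedSpace ℂ h.Hilb :=
  inferInstanceAs (NormedSpace ℂ (UniformSpace.Completion h.Sep))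

instance : CompleteSpace h.Hilb :=
  inferInstanceAs (CompleteSpace (UniformSpace.Completion h.Sep))

instance : Module Cᵐᵒᵖ h.Hilb :=
  inferInstanceAs (Module Cᵐᵒᵖ (UniformSpace.Completion h.Sep))

/-- The inner product, extended by continuity. -/
instance : Inner Cᵐᵒᵖ h.Hilb :=
  inferInstanceAs (Inner Cᵐᵒᵖ (UniformSpace.Completion h.Sep))

/-- The canonical map from `V` to its Hausdorff completion. -/
def mk : V →ₗ[ℂ] h.Hilb :=
  (UniformSpace.Completion.toComplₗᵢ (𝕜 := ℂ) (E := h.Sep)).toLinearMap ∘ₗ Sep.mk h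

theorem denseRange_mk : DenseRange (mk h) :=
  (UniformSpace.Completion.denseRange_coe (α := h.Sep)).comp
    (Sep.mk_surjective h).denseRange (UniformSpace.Completion.continuous_coe _)

theorem inner_mk (v w : V) : inner Cᵐᵒᵖ (mk h v) (mk h w) = MulOpposite.op (h.form v w) :=
  (UniformSpace.Completion.isDenseInducing_coe.prodMap
    UniformSpace.Completion.isDenseInducing_coe).extend_eq
    (CStarModule.continuous_inner (A := Cᵐᵒᵖ) (E := h.Sep)) (Sep.mk h v, Sep.mk h w)

theorem continuous_inner :
    Continuous fun p : h.Hilb × h.Hilb => inner Cᵐᵒᵖ p.1 p.2 := by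
  let inner' : h.Sep →+ h.Sep →+ Cᵐᵒᵖ :=
    { toFun := fun x => (CStarModule.innerₛₗ (A := Cᵐᵒᵖ) x).toAddMonoidHom
      map_zero' := by
        ext x
        exact CStarModule.inner_zero_left (A := Cᵐᵒᵖ) (x := x)
      map_add' := fun x y => by
        ext z
        exact CStarModule.inner_add_left (A := Cᵐᵒᵖ) (x := x) (y := y) (z := z) }
  have hc : Continuous fun p : h.Sep × h.Sep => inner' p.1 p.2 := CStarModule.continuous_inner
  exact (UniformSpace.Completion.isDenseInducing_toCompl h.Sep).extend_Z_bilin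
    (UniformSpace.Completion.isDenseInducing_toCompl h.Sep) hc

theorem op_smul_mk (c : C) (v : V) : MulOpposite.op c • mk h v = mk h (h.act c v) :=
  (UniformSpace.Completion.coe_smul (MulOpposite.op c) (Sep.mk h v)).symm

theorem continuous_op_smul (c : Cᵐᵒᵖ) : Continuous fun x : h.Hilb => c • x :=
  (uniformContinuous_const_smul (X := UniformSpace.Completion h.Sep) c).continuous

theorem continuous_inner_comp {X : Type*} [TopologicalSpace X] {f g : X → h.Hilb}
    (hf : Continuous f) (hg : Continuous g) :
    Continuous fun x => inner Cᵐᵒᵖ (f x) (g x) :=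
  (continuous_inner h).comp (hf.prodMk hg)

theorem norm_mk_sq (v : V) : ‖mk h v‖ ^ 2 = ‖inner Cᵐᵒᵖ (mk h v) (mk h v)‖ := by
  have : ‖mk h v‖ = ‖Sep.mk h v‖ := UniformSpace.Completion.norm_coe _
  rw [this, CStarModule.norm_sq_eq Cᵐᵒᵖ, inner_mk, Sep.inner_mk]

variable {h} in
theorem induction {p : h.Hilb → Prop} (hp : IsClosed {x | p x}) (H : ∀ v, p (mk h v))
    (x : h.Hilb) : p x :=
  (denseRange_mk h).induction_on x hp H

instance : CStarModule Cᵐᵒᵖ h.Hilb where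
  inner_add_right {x y z} := by
    induction x using induction with
    | hp =>
      exact isClosed_eq (continuous_inner_comp h continuous_id continuous_const)
        ((continuous_inner_comp h continuous_id continuous_const).add
          (continuous_inner_comp h continuous_id continuous_const))
    | H u =>
    induction y using induction with
    | hp =>
      exact isClosed_eq
        (continuous_inner_comp h continuous_const (continuous_id.add continuous_const))
        ((continuous_inner_comp h continuous_const continuous_id).add continuous_const)
    | H v =>
    induction z using induction with
    | hp =>
      exact isClosed_eq
        (continuous_inner_comp h continuous_const (continuous_const.add continuous_id))
        (continuous_const.add (continuous_inner_comp h continuous_const continuous_id))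
    | H w => rw [← map_add, inner_mk, inner_mk, inner_mk, map_add, MulOpposite.op_add]
  inner_self_nonneg {x} := by
    induction x using induction with
    | hp =>
      exact isClosed_le continuous_const
        (continuous_inner_comp h continuous_id continuous_id)
    | H u => exact (inner_mk h u u).symm ▸ MulOpposite.op_nonneg.2 (h.form_self_nonneg u)
  inner_self {x} := by
    rw [← norm_eq_zero, ← sq_eq_zero_iff (a := ‖inner Cᵐᵒᵖ x x‖), ← norm_eq_zero (a := x)]
    have : ‖x‖ ^ 2 = ‖inner Cᵐᵒᵖ x x‖ := by
      induction x using induction with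
      | hp =>
      exact isClosed_eq (continuous_norm.pow 2)
          (continuous_inner_comp h continuous_id continuous_id).norm
      | H u => exact norm_mk_sq h u
    rw [← this, sq_eq_zero_iff, sq_eq_zero_iff]
  inner_op_smul_right {c x y} := by
    induction x using induction with
    | hp =>
      exact isClosed_eq (continuous_inner_comp h continuous_id continuous_const)
        (continuous_const.mul (continuous_inner_comp h continuous_id continuous_const))
    | H u =>
    induction y using induction with
    | hp =>
      exact isClosed_eq (continuous_inner_comp h continuous_const (continuous_op_smul h c))
        (continuous_const.mul (continuous_inner_comp h continuous_const continuous_id))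
    | H v =>
    induction c with | _ c
    rw [op_smul_mk, inner_mk, inner_mk, h.form_act, MulOpposite.op_mul]
  inner_smul_right_complex {a x y} := by
    induction x using induction with
    | hp =>
      exact isClosed_eq (continuous_inner_comp h continuous_id continuous_const)
        ((continuous_inner_comp h continuous_id continuous_const).const_smul a)
    | H u =>
    induction y using induction with
    | hp =>
      exact isClosed_eq
        (continuous_inner_comp h continuous_const (continuous_id.const_smul a))
        ((continuous_inner_comp h continuous_const continuous_id).const_smul a)
    | H v => rw [← map_smul, inner_mk, inner_mk, map_smul, MulOpposite.op_smul]
  star_inner x y := by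
    induction x using induction with
    | hp =>
      exact isClosed_eq (continuous_inner_comp h continuous_id continuous_const).star
        (continuous_inner_comp h continuous_const continuous_id)
    | H u =>
    induction y using induction with
    | hp =>
      exact isClosed_eq (continuous_inner_comp h continuous_const continuous_id).star
        (continuous_inner_comp h continuous_id continuous_const)
    | H v => rw [inner_mk, inner_mk, ← MulOpposite.op_star, h.star_form]
  norm_eq_sqrt_norm_inner_self x := by
    have : ‖x‖ ^ 2 = ‖inner Cᵐᵒᵖ x x‖ := by
      induction x using induction with
      | hp =>
        exact isClosed_eq (continuous_norm.pow 2)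
          (continuous_inner_comp h continuous_id continuous_id).norm
      | H u => exact norm_mk_sq h u
    rw [← this, Real.sqrt_sq (norm_nonneg x)]

theorem ip_mk (v w : V) : ip C (mk h v) (mk h w) = h.form v w := by
  rw [ip, inner_mk, MulOpposite.unop_op]

end Hilb
end SemiInner
end Completion

/-! ### The interior tensor product -/

section Positivity

theorem exists_compression_eq_neg {A : Type*} [CStarAlgebra A] [PartialOrder A]
    [StarOrderedRing A] (a : A) (ha : IsSelfAdjoint a) :
    ∃ m d : A, star m * a * m = -(star d * d) ∧ (d = 0 → ∃ e : A, a = star e * e) := by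
  obtain ⟨s, hs⟩ := CStarAlgebra.nonneg_iff_eq_star_mul_self.1 (CFC.negPart_nonneg a)
  have hsa : star a⁻ = a⁻ := (CFC.negPart_nonneg a).isSelfAdjoint
  have hdiff : a⁺ - a⁻ = a := CFC.posPart_sub_negPart a ha
  refine ⟨a⁻, s * a⁻, ?_, fun h => ?_⟩
  · have h1 : a⁻ * a = -(a⁻ * a⁻) := by
      calc a⁻ * a = a⁻ * (a⁺ - a⁻) := by rw [hdiff]
        _ = _ := by rw [mul_sub, CFC.negPart_mul_posPart, zero_sub]
    rw [hsa, h1, star_mul, hsa, mul_assoc, ← mul_assoc (star s), ← hs, neg_mul, mul_assoc]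
  · have h2 : star a⁻ * a⁻ = 0 := by
      rw [hsa]
      nth_rw 1 [hs]
      rw [mul_assoc, h, mul_zero]
    rw [CStarRing.star_mul_self_eq_zero_iff] at h2
    exact CStarAlgebra.nonneg_iff_eq_star_mul_self.1 ((CFC.negPart_eq_zero_iff a ha).1 h2)

theorem eq_zero_of_sum_star_mul_self_nonpos {B : Type*} [CStarAlgebra B] [PartialOrder B]
    [StarOrderedRing B] {n : Type*} [Fintype n] (f : n → B)
    (h : ∑ i, star (f i) * f i ≤ 0) (i : n) : f i = 0 := by
  have h0 : ∑ i, star (f i) * f i = 0 :=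
    le_antisymm h (Finset.sum_nonneg fun i _ => star_mul_self_nonneg _)
  have := (Finset.sum_eq_zero_iff_of_nonneg fun i _ => star_mul_self_nonneg (f i)).1 h0 i
    (Finset.mem_univ i)
  rwa [CStarRing.star_mul_self_eq_zero_iff] at this

variable {B E : Type*} [CStarAlgebra B] [PartialOrder B] [StarOrderedRing B]
  [NormedAddCommGroup E] [NormedSpace ℂ E] [Module Bᵐᵒᵖ E] [CStarModule Bᵐᵒᵖ E]

/-- The Gram matrix of a finite family in a Hilbert module is of the form `m⋆ m`. -/
theorem exists_gram_eq {n : ℕ} (x : Fin n → E) :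
    ∃ m : Fin n → Fin n → B, ∀ i j, ip B (x i) (x j) = ∑ k, star (m k i) * m k j := by
  let : PartialOrder (CStarMatrix (Fin n) (Fin n) B) := CStarAlgebra.spectralOrder _
  have : StarOrderedRing (CStarMatrix (Fin n) (Fin n) B) := CStarAlgebra.spectralOrderedRing _
  let a : CStarMatrix (Fin n) (Fin n) B := CStarMatrix.ofMatrix fun i j => ip B (x i) (x j)
  have haa : ∀ i j, a i j = ip B (x i) (x j) := fun _ _ => rfl
  have ha : IsSelfAdjoint a := by
    ext i j
    rw [CStarMatrix.star_apply, haa, haa, star_ip]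
  obtain ⟨m, d, hmd, hd⟩ := exists_compression_eq_neg a ha
  have hd0 : d = 0 := by
    ext k j
    have h1 : (star m * a * m) j j =
        ip B (∑ i, MulOpposite.op (m i j) • x i) (∑ i, MulOpposite.op (m i j) • x i) := by
      simp only [CStarMatrix.mul_apply, CStarMatrix.star_apply, haa, ip_sum_left, ip_sum_right,
        ip_op_smul_left, ip_op_smul_right, Finset.sum_mul, mul_assoc]
    have h2 : (star d * d) j j = ∑ i, star (d i j) * d i j := by
      simp only [CStarMatrix.mul_apply, CStarMatrix.star_apply]
    have h3 : 0 ≤ (star m * a * m) j j := h1 ▸ ip_self_nonneg B _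
    rw [hmd, CStarMatrix.neg_apply, h2, neg_nonneg] at h3
    exact eq_zero_of_sum_star_mul_self_nonpos (fun i => d i j) h3 k
  obtain ⟨e, he⟩ := hd hd0
  refine ⟨fun k i => e k i, fun i j => ?_⟩
  rw [← haa, he, CStarMatrix.mul_apply]
  simp only [CStarMatrix.star_apply]

end Positivity

section Tensor

variable {B C E F : Type*} [CStarAlgebra B] [PartialOrder B]
  [CStarAlgebra C] [PartialOrder C]
  [NormedAddCommGroup E] [NormedSpace ℂ E] [Module Bᵐᵒᵖ E] [CStarModule Bᵐᵒᵖ E]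
  [NormedAddCommGroup F] [NormedSpace ℂ F] [Module Cᵐᵒᵖ F] [CStarModule Cᵐᵒᵖ F]

variable (E) in
/-- The sesquilinear form on the algebraic tensor product `E ⊗ F` with
`⟨x ⊗ y, x' ⊗ y'⟩ = ⟨y, π(⟨x, x'⟩) y'⟩`. -/
def tensorForm (π : B →⋆ₙₐ[ℂ] Adjointable C F) : E ⊗[ℂ] F →ₗ⋆[ℂ] E ⊗[ℂ] F →ₗ[ℂ] C :=
  TensorProduct.lift <| LinearMap.mk₂'ₛₗ (starRingEnd ℂ) (starRingEnd ℂ)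
    (fun x y => TensorProduct.lift <| LinearMap.mk₂ ℂ (fun x' y' => ip C y (π (ip B x x') y'))
      (fun _ _ _ => by rw [ip_add_right, map_add, Adjointable.add_apply, ip_add_right])
      (fun _ _ _ => by rw [ip_smul_right, map_smul, Adjointable.smul_apply, ip_smul_right])
      (fun _ _ _ => by rw [Adjointable.map_add, ip_add_right])
      (fun _ _ _ => by rw [Adjointable.map_smul, ip_smul_right]))
    (fun _ _ _ => TensorProduct.ext' fun _ _ => by
      simp [ip_add_left, ip_add_right])
    (fun _ _ _ => TensorProduct.ext' fun _ _ => by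
      simp [ip_smul_left, ip_smul_right])
    (fun _ _ _ => TensorProduct.ext' fun _ _ => by
      simp [ip_add_left])
    (fun _ _ _ => TensorProduct.ext' fun _ _ => by
      simp [ip_smul_left])

theorem tensorForm_tmul (π : B →⋆ₙₐ[ℂ] Adjointable C F) (x x' : E) (y y' : F) :
    tensorForm E π (x ⊗ₜ y) (x' ⊗ₜ y') = ip C y (π (ip B x x') y') := rfl

variable (C F) in
/-- Right multiplication by `c`, as a linear map. -/
def rightMul (c : C) : F →ₗ[ℂ] F where
  toFun y := MulOpposite.op c • y
  map_add' _ _ := smul_add _ _ _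
  map_smul' a y := ext_ip (B := C) fun z => by
    simp [ip_smul_right, ip_op_smul_right]

variable [StarOrderedRing B] [StarOrderedRing C]

variable (E) in
/-- The semi-inner product module underlying the interior tensor product. -/
def tensorSemiInner (π : B →⋆ₙₐ[ℂ] Adjointable C F) : SemiInner C (E ⊗[ℂ] F) where
  form := tensorForm E π
  star_form v w := by
    induction v with
    | zero => simp
    | add v v' hv hv' => simp [hv, hv']
    | tmul x y =>
      induction w with
      | zero => simp
      | add w w' hw hw' => simp [hw, hw']
      | tmul x' y' =>
        rw [tensorForm_tmul, tensorForm_tmul, star_ip, Adjointable.ip_toFun,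
          ← Adjointable.star_apply, ← map_star, star_ip]
  form_self_nonneg v := by
    obtain ⟨n, x, y, rfl⟩ := TensorProduct.exists_sum_tmul_eq v
    obtain ⟨m, hm⟩ := exists_gram_eq (B := B) x
    have key : tensorForm E π (∑ j, x j ⊗ₜ y j) (∑ j, x j ⊗ₜ y j) =
        ∑ k, ip C (∑ j, π (m k j) (y j)) (∑ j, π (m k j) (y j)) := by
      simp only [map_sum, LinearMap.sum_apply, tensorForm_tmul, hm, map_mul, map_star,
        Adjointable.sum_apply, Adjointable.mul_apply, Adjointable.star_apply, ip_sum_left,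
        ip_sum_right, Adjointable.ip_toFun]
      exact (Finset.sum_congr rfl fun _ _ => Finset.sum_comm).trans Finset.sum_comm
    rw [key]
    exact Finset.sum_nonneg fun k _ => ip_self_nonneg C _
  act c := LinearMap.lTensor E (rightMul C F c)
  form_act c v w := by
    induction v with
    | zero => simp
    | add v v' hv hv' => simp [hv, hv', add_mul]
    | tmul x y =>
      induction w with
      | zero => simp
      | add w w' hw hw' => simp [hw, hw', add_mul]
      | tmul x' y' =>
        rw [LinearMap.lTensor_tmul, tensorForm_tmul, tensorForm_tmul]
        change ip C y (π (ip B x x') (MulOpposite.op c • y')) = _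
        rw [Adjointable.map_op_smul, ip_op_smul_right]

variable (E) in
/-- The interior tensor product `E ⊙ F` of a Hilbert `B`-module `E` and a `C⋆`-correspondence `F`
from `B` to `C` with left action `π`: the Hilbert `C`-module obtained from the algebraic tensor
product with `⟨x ⊗ y, x' ⊗ y'⟩ = ⟨y, π(⟨x, x'⟩) y'⟩` by separation and completion. -/
abbrev InteriorTensor (π : B →⋆ₙₐ[ℂ] Adjointable C F) : Type _ := (tensorSemiInner E π).Hilb

/-- The elementary tensor `x ⊙ y`. -/
def tmul (π : B →⋆ₙₐ[ℂ] Adjointable C F) (x : E) (y : F) : InteriorTensor E π :=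
  SemiInner.Hilb.mk (tensorSemiInner E π) (x ⊗ₜ y)

theorem ip_tmul (π : B →⋆ₙₐ[ℂ] Adjointable C F) (x x' : E) (y y' : F) :
    ip C (tmul π x y) (tmul π x' y') = ip C y (π (ip B x x') y') :=
  SemiInner.Hilb.ip_mk _ _ _

theorem dense_span_tmul (π : B →⋆ₙₐ[ℂ] Adjointable C F) :
    Dense (Submodule.span ℂ {z | ∃ (x : E) (y : F), z = tmul π x y} :
      Set (InteriorTensor E π)) := by
  refine (SemiInner.Hilb.denseRange_mk (tensorSemiInner E π)).mono ?_
  rintro _ ⟨v, rfl⟩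
  induction v with
  | zero => rw [map_zero]; exact zero_mem _
  | add v w hv hw => rw [map_add]; exact add_mem hv hw
  | tmul x y => exact Submodule.subset_span ⟨x, y, rfl⟩

end Tensor

/-! ### Morphisms and group actions -/

section Action

variable {B C E F : Type*} [CStarAlgebra B] [PartialOrder B] [CStarAlgebra C] [PartialOrder C]
  [NormedAddCommGroup E] [NormedSpace ℂ E] [Module Bᵐᵒᵖ E] [CStarModule Bᵐᵒᵖ E]
  [NormedAddCommGroup F] [NormedSpace ℂ F] [Module Cᵐᵒᵖ F] [CStarModule Cᵐᵒᵖ F]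

variable (C) in
/-- An isometry between Hilbert `C`-modules: a map that preserves inner products. It is
automatically linear over `ℂ` and `C`. -/
def IsIsometry {X : Type*} [NormedAddCommGroup X] [NormedSpace ℂ X] [Module Cᵐᵒᵖ X]
    [CStarModule Cᵐᵒᵖ X] (ν : X → F) : Prop :=
  ∀ z z' : X, ip C (ν z) (ν z') = ip C z z'

variable (B C) in
/-- A morphism of Hilbert modules `E → F` over some `*`-homomorphism `ψ : B → C`. -/
def IsMorphism (Ψ : E → F) : Prop :=
  ∃ ψ : B →⋆ₙₐ[ℂ] C, ∀ x y : E, ip C (Ψ x) (Ψ y) = ψ (ip B x y)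

variable (B E) in
/-- The group `Aut(E)` of the bijections `Ψ` of `E` such that `Ψ` and `Ψ⁻¹` are morphisms. -/
def Aut : Subgroup (Equiv.Perm E) where
  carrier := {Ψ | IsMorphism B B Ψ ∧ IsMorphism B B Ψ.symm}
  one_mem' := ⟨⟨.id ℂ B, fun _ _ => rfl⟩, ⟨.id ℂ B, fun _ _ => rfl⟩⟩
  mul_mem' := by
    rintro Ψ Φ ⟨⟨ψ, hψ⟩, ⟨ψ', hψ'⟩⟩ ⟨⟨φ, hφ⟩, ⟨φ', hφ'⟩⟩
    refine ⟨⟨ψ.comp φ, fun x y => ?_⟩, ⟨φ'.comp ψ', fun x y => ?_⟩⟩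
    · change ip B (Ψ (Φ x)) (Ψ (Φ y)) = ψ (φ (ip B x y))
      rw [hψ, hφ]
    · change ip B (Φ.symm (Ψ.symm x)) (Φ.symm (Ψ.symm y)) = φ' (ψ' (ip B x y))
      rw [hφ', hψ']
  inv_mem' := fun h => ⟨h.2, h.1⟩

/-- The `*`-homomorphism `B → B` induced by an automorphism `Ψ` of `E`,
`⟨x, y⟩ ↦ ⟨Ψ x, Ψ y⟩`; it is unique when `E` is full. -/
def inducedHom (Ψ : Aut B E) : B →⋆ₙₐ[ℂ] B := Ψ.2.1.choose

theorem inducedHom_ip (Ψ : Aut B E) (x y : E) :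
    inducedHom Ψ (ip B x y) = ip B ((Ψ : Equiv.Perm E) x) ((Ψ : Equiv.Perm E) y) :=
  (Ψ.2.1.choose_spec x y).symm

theorem inducedHom_unique (hE : IsFull B E) (Ψ : Aut B E) (ψ : B →⋆ₙₐ[ℂ] B)
    (hψ : ∀ x y : E, ψ (ip B x y) = ip B ((Ψ : Equiv.Perm E) x) ((Ψ : Equiv.Perm E) y)) :
    ψ = inducedHom Ψ := by
  have hc : ∀ φ : B →⋆ₙₐ[ℂ] B, Continuous φ := fun φ =>
    AddMonoidHomClass.continuous_of_bound φ 1 fun b => by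
      rw [one_mul]
      exact NonUnitalStarAlgHom.norm_apply_le φ b
  refine DFunLike.coe_injective ((hc ψ).ext_on hE (hc _) ?_)
  intro b hb
  induction hb using Submodule.span_induction with
  | mem b hb =>
    obtain ⟨x, y, rfl⟩ := hb
    rw [hψ, inducedHom_ip]
  | zero => rw [map_zero, map_zero]
  | add a b _ _ ha hb => rw [map_add, map_add, ha, hb]
  | smul a b _ hb => rw [map_smul, map_smul, hb]

/-- The orbit maps of an action `η` of `G` on the Hilbert module `E` are continuous: together with
`η` and the fullness of `E`, this is a dynamical system `(G, η, E)`. -/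
def IsContinuousAction {G : Type*} [Group G] [TopologicalSpace G] (η : G →* Aut B E) : Prop :=
  ∀ x : E, Continuous fun t => (η t : Equiv.Perm E) x

/-- The action `α^η` on `B` induced by an action `η` on `E`: the maps determined by
`α^η_t ⟨x, y⟩ = ⟨η_t x, η_t y⟩` when `E` is full. -/
def inducedAction {G : Type*} [Group G] (η : G →* Aut B E) (t : G) : B →⋆ₙₐ[ℂ] B :=
  inducedHom (η t)

/-- `v` is strongly continuous; for a homomorphism into the unitary group of the algebra of
adjointable operators this is strict continuity. -/
def IsStronglyContinuous {G : Type*} [Group G] [TopologicalSpace G]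
    (v : G →* unitary (Adjointable C F)) : Prop :=
  ∀ f : F, Continuous fun t => (v t : Adjointable C F) f

end Action

/-! ### Kernels and families of maps -/

section Kernel

variable {B C D E F S : Type*} [CStarAlgebra B] [PartialOrder B] [CStarAlgebra C] [PartialOrder C]
  [CStarAlgebra D]
  [NormedAddCommGroup E] [NormedSpace ℂ E] [Module Bᵐᵒᵖ E] [CStarModule Bᵐᵒᵖ E]
  [NormedAddCommGroup F] [NormedSpace ℂ F] [Module Cᵐᵒᵖ F] [CStarModule Cᵐᵒᵖ F]

/-- `𝔎` is a completely positive definite kernel over `S` from `B` to `C`. -/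
def IsCPDKernel (𝔎 : S → S → B →L[ℂ] C) : Prop :=
  ∀ (n : ℕ) (σ : Fin n → S) (b : Fin n → B) (c : Fin n → C),
    0 ≤ ∑ i, ∑ j, star (c i) * 𝔎 (σ i) (σ j) (star (b i) * b j) * c j

/-- The maps `K σ : E → F` form a `𝔎`-family. -/
def IsKernelFamily (𝔎 : S → S → B →L[ℂ] C) (K : S → E → F) : Prop :=
  ∀ (σ σ' : S) (x x' : E), ip C (K σ x) (K σ' x') = 𝔎 σ σ' (ip B x x')

/-- The family `K` is `(u', u)`-covariant, `K^σ(η_t x) = u'_t K^σ(x) u_t⋆`, where `D` acts on `F`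
from the left through `φ`. -/
def IsCovariant {G : Type*} [Group G] (φ : D →⋆ₙₐ[ℂ] Adjointable C F) (u' : G →* unitary D)
    (u : G →* unitary C) (η : G →* Aut B E) (K : S → E → F) : Prop :=
  ∀ (t : G) (σ : S) (x : E), K σ ((η t : Equiv.Perm E) x) =
    MulOpposite.op (star (u t : C)) • φ (u' t : D) (K σ x)

end Kernel

end HilbertModule
end

open HilbertModule

universe uG uB uC uD uE uF uS

/-! Everything rests on one principle: a map prescribed on a total family of a Hilbert module
extends to an isometry as soon as it preserves the Gram kernel, that is, all inner products within
the family (`IsTotal.exists_isometry`). If a group acts on the family in this way, the extensions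
form a unitary representation (`IsTotal.exists_unitaryRep`).

From (ii) to (i), put 𝔎^{σ,σ'}(b) = ⟨i(σ), b i(σ')⟩. Positivity of inner products makes it
completely positive definite, the isometry ν makes K a 𝔎-family, and i(σ) = v_t i(σ) u_t⋆ gives
K^σ(η_t x) = ν(w'_t(x ⊙ i(σ))) u_t⋆ = u'_t K^σ(x) u_t⋆ (`isCovariant_of_rep`).

From (i) to (ii), 𝓕 is the Kolmogorov decomposition of 𝔎, generated by vectors b i(σ) c with Gram
kernel c⋆ 𝔎^{σ,σ'}(b⋆ b') c'. Three prescriptions preserve Gram kernels: x ⊙ b i(σ) c ↦ K^σ(x b) c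
gives ν (`exists_kernelIsometry`), b i(σ) c ↦ α_t(b) i(σ) u_t c gives v (`exists_kernelUnitaryRep`),
and x ⊙ y ↦ η_t x ⊙ v_t y gives w' (`exists_tensorRep`). The second needs 𝔎(α_t(b)) = u_t 𝔎(b) u_t⋆,
which covariance yields when b is an inner product and fullness of E for every b
(`IsKernelFamily.kernel_inducedAction`). Left multiplication by b is not isometric; it is bounded
because ‖b‖² 1 - b⋆ b is a square d⋆ d (`exists_kernelOp`). -/

noncomputable section

namespace HilbertModule

/-! ### Norm, inner product and continuity in a Hilbert module -/

section Continuity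

variable {C X : Type*} [CStarAlgebra C] [PartialOrder C]
  [NormedAddCommGroup X] [NormedSpace ℂ X] [Module Cᵐᵒᵖ X] [CStarModule Cᵐᵒᵖ X]

variable (C) in
theorem norm_sq_eq_norm_ip (x : X) : ‖x‖ ^ 2 = ‖ip C x x‖ := by
  rw [CStarModule.norm_sq_eq Cᵐᵒᵖ, ip, MulOpposite.norm_unop]

variable (C) in
/-- A map into a Hilbert module is continuous if its Gram kernel is. -/
theorem continuous_of_gram {T : Type*} [TopologicalSpace T] {f : T → X}
    (h : Continuous fun p : T × T => ip C (f p.1) (f p.2)) : Continuous f := by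
  rw [continuous_iff_continuousAt]
  intro s
  -- This is ‖f t - f s‖ with the inner product expanded; it vanishes at t = s.
  have hc : Continuous fun t => √‖ip C (f t) (f t) - ip C (f t) (f s)
      - (ip C (f s) (f t) - ip C (f s) (f s))‖ := by
    refine Real.continuous_sqrt.comp (Continuous.norm ?_)
    exact ((h.comp (continuous_id.prodMk continuous_id)).sub
      (h.comp (continuous_id.prodMk continuous_const))).sub
      ((h.comp (continuous_const.prodMk continuous_id)).sub continuous_const)
  have h0 := hc.tendsto s
  simp only [sub_self, norm_zero, Real.sqrt_zero] at h0
  rw [ContinuousAt, tendsto_iff_norm_sub_tendsto_zero]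
  refine h0.congr fun t => ?_
  rw [← Real.sqrt_sq (norm_nonneg (f t - f s)), norm_sq_eq_norm_ip C, ip_sub_left, ip_sub_right,
    ip_sub_right]

variable [StarOrderedRing C]

theorem norm_ip_le (x y : X) : ‖ip C x y‖ ≤ ‖x‖ * ‖y‖ := by
  rw [ip, MulOpposite.norm_unop]
  exact CStarModule.norm_inner_le X

variable (C) in
theorem continuous_ip {T : Type*} [TopologicalSpace T] {f g : T → X}
    (hf : Continuous f) (hg : Continuous g) : Continuous fun t => ip C (f t) (g t) :=
  MulOpposite.continuous_unop.comp
    ((CStarModule.continuous_inner (A := Cᵐᵒᵖ) (E := X)).comp (hf.prodMk hg))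

end Continuity

/-! ### Contractivity of left actions -/

section Representation

/-- The order-free form of `a⋆ a ≤ ‖a‖²`. -/
theorem exists_norm_sq_smul_one_eq {A : Type*} [CStarAlgebra A] (a : A) :
    ∃ d : A, ((‖a‖ ^ 2 : ℝ) : ℂ) • (1 : A) = star a * a + star d * d := by
  -- The order stays inside the proof: the identity with `d⋆ d` can be pushed through a homomorphism
  -- or a kernel, where an inequality could not.
  let _ : PartialOrder A := CStarAlgebra.spectralOrder A
  have _ : StarOrderedRing A := CStarAlgebra.spectralOrderedRing A
  have h := CStarAlgebra.star_mul_le_algebraMap_norm_sq (a := a)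
  rw [← sub_nonneg, CStarAlgebra.nonneg_iff_eq_star_mul_self] at h
  obtain ⟨d, hd⟩ := h
  refine ⟨d, ?_⟩
  rw [← hd, add_sub_cancel, Algebra.algebraMap_eq_smul_one, Complex.coe_smul]

variable {A C X : Type*} [CStarAlgebra A] [CStarAlgebra C] [PartialOrder C]
  [NormedAddCommGroup X] [NormedSpace ℂ X] [Module Cᵐᵒᵖ X] [CStarModule Cᵐᵒᵖ X]

theorem ip_hom_apply (π : A →⋆ₙₐ[ℂ] Adjointable C X) (a : A) (x y : X) :
    ip C (π a x) y = ip C x (π (star a) y) := by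
  rw [map_star, Adjointable.star_apply, Adjointable.ip_toFun]

theorem ip_hom_apply_hom_apply (π : A →⋆ₙₐ[ℂ] Adjointable C X) (a b : A) (x y : X) :
    ip C (π a x) (π b y) = ip C x (π (star a * b) y) := by
  rw [ip_hom_apply, map_mul, Adjointable.mul_apply]

variable [StarOrderedRing C]

/-- The vector z witnesses ⟨y, y⟩ ≤ M² ⟨x, x⟩, and the norm is monotone on positive elements. -/
theorem norm_le_of_ip_add {x y z : X} {M : ℝ} (hM : 0 ≤ M)
    (h : ((M ^ 2 : ℝ) : ℂ) • ip C x x = ip C y y + ip C z z) : ‖y‖ ≤ M * ‖x‖ := by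
  refine le_of_sq_le_sq ?_ (by positivity)
  have h1 : ip C y y ≤ ((M ^ 2 : ℝ) : ℂ) • ip C x x := by
    rw [h]
    exact le_add_of_nonneg_right (ip_self_nonneg C z)
  have h2 := CStarAlgebra.norm_le_norm_of_nonneg_of_le (ip_self_nonneg C y) h1
  rwa [norm_smul, Complex.norm_real, Real.norm_of_nonneg (by positivity), ← norm_sq_eq_norm_ip,
    ← norm_sq_eq_norm_ip, ← mul_pow] at h2

/-- Applying π to ‖a‖² 1 = a⋆ a + d⋆ d bounds π(a) x by ‖a‖ times the length of π(1) x. As π need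
not be unital, the projection π(1) is shown separately to be contractive. -/
theorem norm_hom_apply_le (π : A →⋆ₙₐ[ℂ] Adjointable C X) (a : A) (x : X) :
    ‖π a x‖ ≤ ‖a‖ * ‖x‖ := by
  have h1 : ‖π 1 x‖ ≤ ‖x‖ := by
    rw [← one_mul ‖x‖]
    refine norm_le_of_ip_add (C := C) zero_le_one (z := x - π 1 x) ?_
    have e : ip C (π 1 x) (π 1 x) = ip C x (π 1 x) := by
      rw [ip_hom_apply_hom_apply, star_one, one_mul]
    have e' : ip C (π 1 x) x = ip C x (π 1 x) := by
      rw [ip_hom_apply, star_one]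
    rw [ip_sub_left, ip_sub_right, ip_sub_right, e, e']
    simp
  obtain ⟨d, hd⟩ := exists_norm_sq_smul_one_eq a
  refine (norm_le_of_ip_add (C := C) (x := π 1 x) (z := π d x) (norm_nonneg a) ?_).trans
    (mul_le_mul_of_nonneg_left h1 (norm_nonneg a))
  rw [ip_hom_apply_hom_apply, ip_hom_apply_hom_apply, ip_hom_apply_hom_apply, ← ip_add_right,
    ← Adjointable.add_apply, ← map_add, ← hd, map_smul, Adjointable.smul_apply, ip_smul_right,
    star_one, one_mul]

/-- The left action, as a bounded operator. -/
def homCLM (π : A →⋆ₙₐ[ℂ] Adjointable C X) (a : A) : X →L[ℂ] X :=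
  LinearMap.mkContinuous
    { toFun := fun x => π a x
      map_add' := (π a).map_add
      map_smul' := (π a).map_smul } ‖a‖ (norm_hom_apply_le π a)

theorem homCLM_apply (π : A →⋆ₙₐ[ℂ] Adjointable C X) (a : A) (x : X) :
    homCLM π a x = π a x := rfl

end Representation

/-! ### Extending maps from total families -/

section Total

/-- A family in a normed space is total if its closed linear span is everything. -/
def IsTotal {I X : Type*} [NormedAddCommGroup X] [NormedSpace ℂ X] (a : I → X) : Prop :=
  Dense (Submodule.span ℂ (Set.range a) : Set X)

theorem IsTotal.clm_ext {I X Y : Type*} [NormedAddCommGroup X] [NormedSpace ℂ X]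
    [NormedAddCommGroup Y] [NormedSpace ℂ Y] {a : I → X} (ha : IsTotal a) {S T : X →L[ℂ] Y}
    (h : ∀ i, S (a i) = T (a i)) : S = T :=
  ContinuousLinearMap.ext_on ha (by rintro _ ⟨i, rfl⟩; exact h i)

/-- A total family may be linearly dependent; the bound on all linear combinations makes a_i ↦ b_i
well defined on the span and bounded there. -/
theorem IsTotal.exists_clm {I X Y : Type*} [NormedAddCommGroup X] [NormedSpace ℂ X]
    [NormedAddCommGroup Y] [NormedSpace ℂ Y] [CompleteSpace Y] {a : I → X} (ha : IsTotal a)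
    (b : I → Y) (M : ℝ) (h : ∀ l : I →₀ ℂ,
      ‖Finsupp.linearCombination ℂ b l‖ ≤ M * ‖Finsupp.linearCombination ℂ a l‖) :
    ∃ T : X →L[ℂ] Y, ∀ i, T (a i) = b i := by
  have hd : DenseRange (Finsupp.linearCombination ℂ a) := by
    rw [DenseRange, ← LinearMap.coe_range, Finsupp.range_linearCombination]
    exact ha
  refine ⟨(Finsupp.linearCombination ℂ b).extendOfNorm (Finsupp.linearCombination ℂ a),
    fun i => ?_⟩
  have := LinearMap.extendOfNorm_eq hd ⟨M, h⟩ (Finsupp.single i 1)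
  simpa using this

/-- Strong continuity of a family of contractions may be checked on a total set. -/
theorem continuous_apply_of_dense_span {T X Y : Type*} [TopologicalSpace T]
    [NormedAddCommGroup X] [NormedSpace ℂ X] [NormedAddCommGroup Y] [NormedSpace ℂ Y] {s : Set X}
    {A : T → X →L[ℂ] Y} (hs : Dense (Submodule.span ℂ s : Set X)) (hA : ∀ t x, ‖A t x‖ ≤ ‖x‖)
    (h : ∀ x ∈ s, Continuous fun t => A t x) (x : X) : Continuous fun t => A t x := by
  have hspan : ∀ y ∈ Submodule.span ℂ s, Continuous fun t => A t y := by
    intro y hy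
    induction hy using Submodule.span_induction with
    | mem y hy => exact h y hy
    | zero => simpa only [map_zero] using continuous_const
    | add y z _ _ hy hz => simp only [map_add]; exact hy.add hz
    | smul c y _ hy => simp only [map_smul]; exact hy.const_smul c
  rw [continuous_iff_continuousAt]
  intro t₀
  rw [ContinuousAt, Metric.tendsto_nhds]
  intro ε hε
  obtain ⟨y, hy, hxy⟩ := Metric.mem_closure_iff.1 (hs x) (ε / 3) (by positivity)
  -- Contractivity makes the approximation uniform in t.
  have hdist : ∀ t, dist (A t x) (A t y) ≤ dist x y := by
    intro t
    rw [dist_eq_norm, ← map_sub, dist_eq_norm]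
    exact hA t _
  filter_upwards [Metric.tendsto_nhds.1 ((hspan y hy).tendsto t₀) (ε / 3) (by positivity)]
    with t ht
  have h1 := dist_triangle4 (A t x) (A t y) (A t₀ y) (A t₀ x)
  have h2 := hdist t
  have h3 := hdist t₀
  rw [dist_comm] at h3
  linarith

variable {C I X Y Z : Type*} [CStarAlgebra C] [PartialOrder C]
  [NormedAddCommGroup Y] [NormedSpace ℂ Y] [Module Cᵐᵒᵖ Y] [CStarModule Cᵐᵒᵖ Y]

/-- The squared length of the defect involves only inner products of images; moved back to the
domain, they cancel. Both kinds of homogeneity follow in the same way. -/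
theorem IsIsometry.map_add [NormedAddCommGroup X] [NormedSpace ℂ X] [Module Cᵐᵒᵖ X]
    [CStarModule Cᵐᵒᵖ X] {ν : X → Y} (hν : IsIsometry C ν) (x y : X) :
    ν (x + y) = ν x + ν y := by
  rw [← sub_eq_zero, ← ip_self_eq_zero C]
  simp only [ip_sub_left, ip_sub_right, ip_add_left, ip_add_right, hν _ _]
  abel

theorem IsIsometry.map_smul [NormedAddCommGroup X] [NormedSpace ℂ X] [Module Cᵐᵒᵖ X]
    [CStarModule Cᵐᵒᵖ X] {ν : X → Y} (hν : IsIsometry C ν) (c : ℂ) (x : X) :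
    ν (c • x) = c • ν x := by
  rw [← sub_eq_zero, ← ip_self_eq_zero C]
  simp only [ip_sub_left, ip_sub_right, ip_smul_left, ip_smul_right, hν _ _]
  rw [smul_comm c]
  simp

theorem IsIsometry.map_op_smul [NormedAddCommGroup X] [NormedSpace ℂ X] [Module Cᵐᵒᵖ X]
    [CStarModule Cᵐᵒᵖ X] {ν : X → Y} (hν : IsIsometry C ν) (c : C) (x : X) :
    ν (MulOpposite.op c • x) = MulOpposite.op c • ν x := by
  rw [← sub_eq_zero, ← ip_self_eq_zero C]
  simp only [ip_sub_left, ip_sub_right, ip_op_smul_left, ip_op_smul_right, hν _ _]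
  simp [mul_assoc]

theorem IsIsometry.norm_map [NormedAddCommGroup X] [NormedSpace ℂ X] [Module Cᵐᵒᵖ X]
    [CStarModule Cᵐᵒᵖ X] {ν : X → Y} (hν : IsIsometry C ν) (x : X) : ‖ν x‖ = ‖x‖ := by
  rw [← sq_eq_sq₀ (norm_nonneg _) (norm_nonneg _), norm_sq_eq_norm_ip C, norm_sq_eq_norm_ip C, hν]

/-- An isometry, as a bounded operator. -/
def IsIsometry.toCLM [NormedAddCommGroup X] [NormedSpace ℂ X] [Module Cᵐᵒᵖ X]
    [CStarModule Cᵐᵒᵖ X] {ν : X → Y} (hν : IsIsometry C ν) : X →L[ℂ] Y :=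
  LinearMap.mkContinuous ⟨⟨ν, hν.map_add⟩, hν.map_smul⟩ 1 fun x => by
    rw [one_mul]; exact (hν.norm_map x).le

theorem IsIsometry.toCLM_apply [NormedAddCommGroup X] [NormedSpace ℂ X] [Module Cᵐᵒᵖ X]
    [CStarModule Cᵐᵒᵖ X] {ν : X → Y} (hν : IsIsometry C ν) (x : X) : hν.toCLM x = ν x := rfl

theorem isIsometry_unitary (v : unitary (Adjointable C Y)) :
    IsIsometry C (v : Adjointable C Y) := fun x y => by
  rw [Adjointable.ip_toFun, ← Adjointable.star_apply, ← Adjointable.mul_apply,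
    Unitary.coe_star_mul_self, Adjointable.one_apply]

/-- Strong continuity of a unitary representation may be checked on a total family. -/
theorem IsTotal.isStronglyContinuous {G : Type*} [Group G] [TopologicalSpace G] {a : I → Y}
    (ha : IsTotal a) {v : G →* unitary (Adjointable C Y)}
    (h : ∀ i, Continuous fun t => (v t : Adjointable C Y) (a i)) : IsStronglyContinuous v := by
  refine continuous_apply_of_dense_span (A := fun t => (isIsometry_unitary (v t)).toCLM) ha
    (fun t x => ((isIsometry_unitary (v t)).norm_map x).le) ?_
  rintro _ ⟨i, rfl⟩
  exact h i

variable [StarOrderedRing C] [NormedAddCommGroup X] [NormedSpace ℂ X]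
  [NormedAddCommGroup Z] [NormedSpace ℂ Z] [Module Cᵐᵒᵖ Z] [CStarModule Cᵐᵒᵖ Z]
  {a : I → X}

/-- Two bounded sesquilinear expressions agree if they do so on a total family. -/
theorem IsTotal.ip_ext (ha : IsTotal a) {S T : X →L[ℂ] Y} {S' T' : X →L[ℂ] Z}
    (h : ∀ i j, ip C (S (a i)) (T (a j)) = ip C (S' (a i)) (T' (a j))) (x y : X) :
    ip C (S x) (T y) = ip C (S' x) (T' y) := by
  have h1 : ∀ i, ip C (S (a i)) (T y) = ip C (S' (a i)) (T' y) := by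
    intro i
    refine ha.induction (P := fun y => ip C (S (a i)) (T y) = ip C (S' (a i)) (T' y)) ?_
      (isClosed_eq (continuous_ip C continuous_const T.continuous)
        (continuous_ip C continuous_const T'.continuous)) y
    intro y hy
    induction hy using Submodule.span_induction with
    | mem y hy => obtain ⟨j, rfl⟩ := hy; exact h i j
    | zero => simp only [map_zero, ip_zero_right]
    | add y z _ _ hy hz => simp only [map_add, ip_add_right, hy, hz]
    | smul c y _ hy => simp only [map_smul, ip_smul_right, hy]
  refine ha.induction (P := fun x => ip C (S x) (T y) = ip C (S' x) (T' y)) ?_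
    (isClosed_eq (continuous_ip C S.continuous continuous_const)
      (continuous_ip C S'.continuous continuous_const)) x
  intro x hx
  induction hx using Submodule.span_induction with
  | mem x hx => obtain ⟨j, rfl⟩ := hx; exact h1 j
  | zero => simp only [map_zero, ip_zero_left]
  | add y z _ _ hy hz => simp only [map_add, ip_add_left, hy, hz]
  | smul c y _ hy => simp only [map_smul, ip_smul_left, hy]

variable [Module Cᵐᵒᵖ X] [CStarModule Cᵐᵒᵖ X]

/-- A map between families with the same Gram kernel extends to an isometry. -/
theorem IsTotal.exists_isometry [CompleteSpace Y] (ha : IsTotal a) (b : I → Y)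
    (h : ∀ i j, ip C (b i) (b j) = ip C (a i) (a j)) :
    ∃ T : X →L[ℂ] Y, IsIsometry C T ∧ ∀ i, T (a i) = b i := by
  obtain ⟨T, hT⟩ := ha.exists_clm b 1 fun l => by
    rw [one_mul]
    -- The bound 1 is attained: equal Gram kernels give equal norms of corresponding linear
    -- combinations.
    refine le_of_eq ((sq_eq_sq₀ (norm_nonneg _) (norm_nonneg _)).1 ?_)
    rw [norm_sq_eq_norm_ip C, norm_sq_eq_norm_ip C]
    simp only [Finsupp.linearCombination_apply, Finsupp.sum, ip_sum_left, ip_sum_right,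
      ip_smul_left, ip_smul_right, h]
  refine ⟨T, fun x y => ?_, hT⟩
  exact ha.ip_ext (S := T) (T := T) (S' := .id ℂ X) (T' := .id ℂ X)
    (fun i j => by simp only [hT, h, ContinuousLinearMap.id_apply]) x y

/-- An action on a total family that preserves the Gram kernel extends to a unitary
representation. -/
theorem IsTotal.exists_unitaryRep {G : Type*} [Group G] [CompleteSpace X] (ha : IsTotal a)
    (ρ : G → I → I) (hone : ∀ i, ρ 1 i = i) (hmul : ∀ s t i, ρ (s * t) i = ρ s (ρ t i))
    (h : ∀ t i j, ip C (a (ρ t i)) (a (ρ t j)) = ip C (a i) (a j)) :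
    ∃ v : G →* unitary (Adjointable C X), ∀ t i, (v t : Adjointable C X) (a i) = a (ρ t i) := by
  choose T hT hTa using fun t => ha.exists_isometry (fun i => a (ρ t i)) (h t)
  have hTmul : ∀ s t x, T (s * t) x = T s (T t x) := fun s t x => by
    have : T (s * t) = (T s).comp (T t) := ha.clm_ext fun i => by
      simp only [hTa, hmul, ContinuousLinearMap.comp_apply]
    rw [this, ContinuousLinearMap.comp_apply]
  have hTone : ∀ x, T 1 x = x := fun x => by
    have : T 1 = .id ℂ X := ha.clm_ext fun i => by
      simp only [hTa, hone, ContinuousLinearMap.id_apply]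
    rw [this, ContinuousLinearMap.id_apply]
  -- An isometry of Hilbert modules need not be adjointable; here the group inverse supplies the
  -- adjoint, since ⟨T_t x, y⟩ = ⟨T_t x, T_t T_{t⁻¹} y⟩ = ⟨x, T_{t⁻¹} y⟩.
  let V : G → Adjointable C X := fun t => ⟨T t, T t⁻¹, fun x y => by
    rw [← hT t x, ← hTmul, mul_inv_cancel, hTone]⟩
  refine ⟨⟨⟨fun t => ⟨V t, ?_⟩, ?_⟩, ?_⟩, hTa⟩
  · rw [Unitary.mem_iff]
    constructor <;> ext x
    · change T t⁻¹ (T t x) = x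
      rw [← hTmul, inv_mul_cancel, hTone]
    · change T t (T t⁻¹ x) = x
      rw [← hTmul, mul_inv_cancel, hTone]
  · exact Subtype.ext (Adjointable.ext hTone)
  · exact fun s t => Subtype.ext (Adjointable.ext (hTmul s t))

end Total

/-! ### Elementary tensors of the interior tensor product -/

section TensorProduct

variable {B C E X : Type*} [CStarAlgebra B] [PartialOrder B] [StarOrderedRing B]
  [CStarAlgebra C] [PartialOrder C] [StarOrderedRing C]
  [NormedAddCommGroup E] [NormedSpace ℂ E] [Module Bᵐᵒᵖ E] [CStarModule Bᵐᵒᵖ E]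
  [NormedAddCommGroup X] [NormedSpace ℂ X] [Module Cᵐᵒᵖ X] [CStarModule Cᵐᵒᵖ X]
  (π : B →⋆ₙₐ[ℂ] Adjointable C X)

theorem norm_tmul_le (x : E) (y : X) : ‖tmul π x y‖ ≤ ‖x‖ * ‖y‖ := by
  refine le_of_sq_le_sq ?_ (by positivity)
  rw [norm_sq_eq_norm_ip C, ip_tmul]
  calc ‖ip C y (π (ip B x x) y)‖ ≤ ‖y‖ * (‖ip B x x‖ * ‖y‖) :=
        (norm_ip_le y _).trans (mul_le_mul_of_nonneg_left (norm_hom_apply_le π _ _) (norm_nonneg _))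
    _ = (‖x‖ * ‖y‖) ^ 2 := by rw [← norm_sq_eq_norm_ip]; ring

variable (E) in
/-- The map `(x, y) ↦ x ⊙ y`, as a bounded bilinear map. -/
def tmulCLM : E →L[ℂ] X →L[ℂ] InteriorTensor E π :=
  LinearMap.mkContinuous₂
    ((TensorProduct.mk ℂ E X).compr₂ (SemiInner.Hilb.mk (tensorSemiInner E π)))
    1 fun x y => by rw [one_mul]; exact norm_tmul_le π x y

theorem tmulCLM_apply (x : E) (y : X) : tmulCLM E π x y = tmul π x y := rfl

theorem continuous_tmul {T : Type*} [TopologicalSpace T] {f : T → E} {g : T → X}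
    (hf : Continuous f) (hg : Continuous g) : Continuous fun t => tmul π (f t) (g t) :=
  ((tmulCLM E π).continuous.comp hf).clm_apply hg

theorem isTotal_tmul : IsTotal fun p : E × X => tmul π p.1 p.2 := by
  refine (dense_span_tmul (E := E) π).mono (Submodule.span_mono ?_)
  rintro _ ⟨x, y, rfl⟩
  exact ⟨(x, y), rfl⟩

-- For fixed x the map y ↦ x ⊙ y is bounded and linear, so approximating y by the span of `a`
-- approximates x ⊙ y.
variable (E) in
theorem IsTotal.tmul {I : Type*} {a : I → X} (ha : IsTotal a) :
    IsTotal fun p : E × I => HilbertModule.tmul π p.1 (a p.2) := by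
  have hsub : ∀ (x : E) (y : X), HilbertModule.tmul π x y ∈ closure (Submodule.span ℂ (Set.range
      fun p : E × I => HilbertModule.tmul π p.1 (a p.2)) : Set (InteriorTensor E π)) := by
    intro x y
    rw [← tmulCLM_apply]
    refine map_mem_closure (tmulCLM E π x).continuous (ha y) ?_
    intro y hy
    induction hy using Submodule.span_induction with
    | mem y hy => obtain ⟨i, rfl⟩ := hy; exact Submodule.subset_span ⟨(x, i), rfl⟩
    | zero => rw [map_zero]; exact zero_mem _
    | add y z _ _ hy hz => rw [map_add]; exact add_mem hy hz
    | smul c y _ hy => rw [map_smul]; exact Submodule.smul_mem _ c hy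
  refine dense_closure.1 ((isTotal_tmul (E := E) π).mono ?_)
  rw [← Submodule.topologicalClosure_coe, SetLike.coe_subset_coe, Submodule.span_le]
  rintro _ ⟨⟨x, y⟩, rfl⟩
  exact hsub x y

-- The length of x ⊙ y - x' ⊙ y' sees y and y' only through the left action of inner products. Hence
-- y and π(1) y give the same tensors even when π is not unital.
variable {π} in
theorem tmul_eq_tmul {x x' : E} {y y' : X}
    (h : ∀ z : E, π (ip B z x) y = π (ip B z x') y') : tmul π x y = tmul π x' y' := by
  rw [← sub_eq_zero, ← ip_self_eq_zero C, ip_sub_left, ip_sub_right, ip_sub_right]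
  simp only [ip_tmul, h, sub_self]

theorem tmul_hom_apply (x : E) (b : B) (y : X) :
    tmul π x (π b y) = tmul π (MulOpposite.op b • x) y :=
  tmul_eq_tmul fun z => by rw [ip_op_smul_right, map_mul, Adjointable.mul_apply]

theorem op_smul_tmul (c : C) (x : E) (y : X) :
    MulOpposite.op c • tmul π x y = tmul π x (MulOpposite.op c • y) :=
  SemiInner.Hilb.op_smul_mk _ c _

end TensorProduct

/-! ### The induced action on the coefficient algebra -/

section InducedAction

variable {B E : Type*} [CStarAlgebra B] [PartialOrder B]
  [NormedAddCommGroup E] [NormedSpace ℂ E] [Module Bᵐᵒᵖ E] [CStarModule Bᵐᵒᵖ E]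

theorem IsFull.clm_ext {N : Type*} [NormedAddCommGroup N] [NormedSpace ℂ N] (hE : IsFull B E)
    {f g : B →L[ℂ] N} (h : ∀ x y : E, f (ip B x y) = g (ip B x y)) : f = g :=
  ContinuousLinearMap.ext_on hE (by rintro _ ⟨x, y, rfl⟩; exact h x y)

/-- A `⋆`-homomorphism between `C⋆`-algebras, as a bounded operator. -/
def starHomCLM {A B : Type*} [CStarAlgebra A] [CStarAlgebra B] (ψ : B →⋆ₙₐ[ℂ] A) : B →L[ℂ] A :=
  LinearMap.mkContinuous ⟨⟨ψ, map_add ψ⟩, map_smul ψ⟩ 1 fun b => by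
    rw [one_mul]; exact NonUnitalStarAlgHom.norm_apply_le ψ b

theorem starHomCLM_apply {A B : Type*} [CStarAlgebra A] [CStarAlgebra B] (ψ : B →⋆ₙₐ[ℂ] A) (b : B) :
    starHomCLM ψ b = ψ b := rfl

variable {G : Type*} [Group G] (η : G →* Aut B E)

theorem inducedAction_ip (t : G) (x y : E) :
    inducedAction η t (ip B x y) =
      ip B ((η t : Equiv.Perm E) x) ((η t : Equiv.Perm E) y) := inducedHom_ip _ _ _

theorem action_one_apply (x : E) : (η 1 : Equiv.Perm E) x = x := by
  rw [map_one]; rfl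

theorem action_mul_apply (s t : G) (x : E) :
    (η (s * t) : Equiv.Perm E) x = (η s : Equiv.Perm E) ((η t : Equiv.Perm E) x) := by
  rw [map_mul]; rfl

theorem action_apply_inv_apply (t : G) (x : E) :
    (η t : Equiv.Perm E) ((η t⁻¹ : Equiv.Perm E) x) = x := by
  rw [← action_mul_apply, mul_inv_cancel, action_one_apply]

/-- Since η_t is onto, it suffices to test against vectors η_t z, where the inner products are
values of the multiplicative map α_t. -/
theorem action_op_smul (t : G) (x : E) (b : B) :
    (η t : Equiv.Perm E) (MulOpposite.op b • x) =
      MulOpposite.op (inducedAction η t b) • (η t : Equiv.Perm E) x := by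
  refine ext_ip (B := B) fun z => ?_
  rw [← action_apply_inv_apply η t z, ip_op_smul_right, ← inducedAction_ip, ← inducedAction_ip,
    ip_op_smul_right, map_mul]

variable {η}

/-- Each α_t is known only on inner products, so the group laws for α are checked there and extended
by fullness and continuity. -/
theorem inducedAction_one_apply (hE : IsFull B E) (b : B) : inducedAction η 1 b = b := by
  have : starHomCLM (inducedAction η 1) = .id ℂ B := hE.clm_ext fun x y => by
    rw [starHomCLM_apply, inducedAction_ip, action_one_apply, action_one_apply]; rfl
  rw [← starHomCLM_apply, this]; rfl

theorem inducedAction_mul_apply (hE : IsFull B E) (s t : G) (b : B) :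
    inducedAction η (s * t) b = inducedAction η s (inducedAction η t b) := by
  have : starHomCLM (inducedAction η (s * t)) =
      (starHomCLM (inducedAction η s)).comp (starHomCLM (inducedAction η t)) :=
    hE.clm_ext fun x y => by
      simp only [starHomCLM_apply, inducedAction_ip, action_mul_apply,
        ContinuousLinearMap.comp_apply]
  rw [← starHomCLM_apply, this]; rfl

theorem inducedAction_apply_inv_apply (hE : IsFull B E) (t : G) (b : B) :
    inducedAction η t (inducedAction η t⁻¹ b) = b := by
  rw [← inducedAction_mul_apply hE, mul_inv_cancel, inducedAction_one_apply hE]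

/-- The homomorphism α_t is not unital by definition, but it is onto, and α_t(1) is a unit for its
range. -/
theorem inducedAction_apply_one (hE : IsFull B E) (t : G) : inducedAction η t 1 = 1 := by
  have h := map_mul (inducedAction η t) 1 (inducedAction η t⁻¹ 1)
  rwa [one_mul, inducedAction_apply_inv_apply hE, mul_one, eq_comm] at h

theorem continuous_inducedAction [StarOrderedRing B] [TopologicalSpace G] (hE : IsFull B E)
    (hη : IsContinuousAction η) (b : B) : Continuous fun t => inducedAction η t b := by
  refine continuous_apply_of_dense_span (A := fun t => starHomCLM (inducedAction η t)) hE
    (fun t b => NonUnitalStarAlgHom.norm_apply_le (inducedAction η t) b) ?_ b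
  rintro _ ⟨x, y, rfl⟩
  simp only [starHomCLM_apply, inducedAction_ip]
  exact continuous_ip B (hη x) (hη y)

end InducedAction

/-! ### The Kolmogorov decomposition of a kernel -/

section Dilation

variable {B C S : Type*} [CStarAlgebra B] [CStarAlgebra C] [PartialOrder C]

/-- The sesquilinear form `⟨c_{σ,b}, c'_{σ',b'}⟩ = c⋆ 𝔎^{σ,σ'}(b⋆ b') c'`. -/
def kernelForm (𝔎 : S → S → B →L[ℂ] C) : (S × B →₀ C) →ₗ⋆[ℂ] (S × B →₀ C) →ₗ[ℂ] C :=
  LinearMap.mk₂'ₛₗ (starRingEnd ℂ) (RingHom.id ℂ)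
    (fun f g => f.sum fun p c => g.sum fun q d => star c * 𝔎 p.1 q.1 (star p.2 * q.2) * d)
    (fun f f' g => by
      rw [Finsupp.sum_add_index'] <;> intros <;>
        simp only [star_zero, zero_mul, Finsupp.sum, Finset.sum_const_zero, star_add, add_mul,
          Finset.sum_add_distrib])
    (fun a f g => by
      rw [Finsupp.sum_smul_index']
      · simp only [star_smul, smul_mul_assoc, Finsupp.smul_sum]; rfl
      · intro; simp only [star_zero, zero_mul, Finsupp.sum, Finset.sum_const_zero])
    (fun f g g' => by
      rw [← Finsupp.sum_add]
      refine Finsupp.sum_congr fun p _ => ?_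
      rw [Finsupp.sum_add_index'] <;> intros <;> simp only [mul_zero, mul_add])
    (fun a f g => by
      rw [Finsupp.smul_sum]
      refine Finsupp.sum_congr fun p _ => ?_
      rw [Finsupp.sum_smul_index', Finsupp.smul_sum]
      · simp only [mul_smul_comm]; rfl
      · intro; simp only [mul_zero])

omit [PartialOrder C] in
theorem kernelForm_apply (𝔎 : S → S → B →L[ℂ] C) (f g : S × B →₀ C) :
    kernelForm 𝔎 f g =
      f.sum fun p c => g.sum fun q d => star c * 𝔎 p.1 q.1 (star p.2 * q.2) * d := rfl

omit [PartialOrder C] in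
theorem kernelForm_single (𝔎 : S → S → B →L[ℂ] C) (p q : S × B) (c d : C) :
    kernelForm 𝔎 (Finsupp.single p c) (Finsupp.single q d) =
      star c * 𝔎 p.1 q.1 (star p.2 * q.2) * d := by
  rw [kernelForm_apply, Finsupp.sum_single_index, Finsupp.sum_single_index] <;> simp

/-- The semi-inner product module underlying the Kolmogorov decomposition of a kernel. -/
def kernelSemiInner (𝔎 : S → S → B →L[ℂ] C) (h𝔎 : IsCPDKernel 𝔎)
    (hstar : ∀ σ σ' b, star (𝔎 σ σ' b) = 𝔎 σ' σ (star b)) : SemiInner C (S × B →₀ C) where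
  form := kernelForm 𝔎
  star_form f g := by
    rw [kernelForm_apply, kernelForm_apply, Finsupp.sum_comm]
    simp only [Finsupp.sum, star_sum, star_mul, star_star, hstar, mul_assoc]
  form_self_nonneg f := by
    -- Positivity of the kernel is stated for families over `Fin n`, so the support is enumerated,
    -- with the values of `f` as the coefficients c_i.
    let e := f.support.equivFin
    have h := h𝔎 _ (fun i => (e.symm i).1.1) (fun i => (e.symm i).1.2) (fun i => f (e.symm i).1)
    refine h.trans_eq ?_
    rw [kernelForm_apply, Finsupp.sum, ← Finset.sum_coe_sort f.support]
    refine Fintype.sum_equiv e.symm _ _ fun i => ?_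
    rw [Finsupp.sum, ← Finset.sum_coe_sort f.support]
    exact Fintype.sum_equiv e.symm _ _ fun j => rfl
  act c := Finsupp.mapRange (· * c) (zero_mul c)
  form_act c f g := by
    rw [kernelForm_apply, kernelForm_apply, Finsupp.sum_mul]
    refine Finsupp.sum_congr fun p _ => ?_
    rw [Finsupp.sum_mapRange_index (by simp), Finsupp.sum_mul]
    simp only [mul_assoc]

variable [StarOrderedRing C]

variable {𝔎 : S → S → B →L[ℂ] C} (h𝔎 : IsCPDKernel 𝔎)
  (hstar : ∀ σ σ' b, star (𝔎 σ σ' b) = 𝔎 σ' σ (star b))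

/-- The vector `b i(σ) c` of the Kolmogorov decomposition. -/
def kernelVec (p : S × B × C) : (kernelSemiInner 𝔎 h𝔎 hstar).Hilb :=
  SemiInner.Hilb.mk _ (Finsupp.single (p.1, p.2.1) p.2.2)

theorem ip_kernelVec (p q : S × B × C) :
    ip C (kernelVec h𝔎 hstar p) (kernelVec h𝔎 hstar q) =
      star p.2.2 * 𝔎 p.1 q.1 (star p.2.1 * q.2.1) * q.2.2 :=
  (SemiInner.Hilb.ip_mk _ _ _).trans (kernelForm_single _ _ _ _ _)

theorem isTotal_kernelVec : IsTotal (kernelVec h𝔎 hstar) := by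
  refine (SemiInner.Hilb.denseRange_mk (kernelSemiInner 𝔎 h𝔎 hstar)).mono ?_
  rintro _ ⟨f, rfl⟩
  induction f using Finsupp.induction_linear with
  | zero => rw [map_zero]; exact zero_mem _
  | add f g hf hg => rw [map_add]; exact add_mem hf hg
  | single p c => exact Submodule.subset_span ⟨(p.1, p.2, c), rfl⟩

theorem op_smul_kernelVec (c d : C) (σ : S) (b : B) :
    MulOpposite.op d • kernelVec h𝔎 hstar (σ, b, c) = kernelVec h𝔎 hstar (σ, b, c * d) := by
  refine (SemiInner.Hilb.op_smul_mk _ _ _).trans ?_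
  exact congrArg _ (Finsupp.mapRange_single (hf := zero_mul d))

/-- With ‖b‖² 1 = b⋆ b + d⋆ d placed between the algebra entries of the kernel, ‖b‖² ⟨x, x⟩ = ⟨b x,
b x⟩ + ⟨d x, d x⟩ for every combination x of the generators, and the last term is positive. -/
theorem exists_kernelOp (b : B) : ∃ T : (kernelSemiInner 𝔎 h𝔎 hstar).Hilb →L[ℂ]
    (kernelSemiInner 𝔎 h𝔎 hstar).Hilb,
    ∀ p, T (kernelVec h𝔎 hstar p) = kernelVec h𝔎 hstar (p.1, b * p.2.1, p.2.2) := by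
  refine (isTotal_kernelVec h𝔎 hstar).exists_clm _ ‖b‖ fun l => ?_
  obtain ⟨d, hd⟩ := exists_norm_sq_smul_one_eq b
  refine norm_le_of_ip_add (C := C) (z := Finsupp.linearCombination ℂ
    (fun p : S × B × C => kernelVec h𝔎 hstar (p.1, d * p.2.1, p.2.2)) l) (norm_nonneg b) ?_
  simp only [Finsupp.linearCombination_apply, Finsupp.sum, ip_sum_left, ip_sum_right,
    ip_smul_left, ip_smul_right, Finset.smul_sum, ← Finset.sum_add_distrib, ip_kernelVec]
  refine Finset.sum_congr rfl fun p _ => Finset.sum_congr rfl fun q _ => ?_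
  have h : ((‖b‖ ^ 2 : ℝ) : ℂ) • 𝔎 q.1 p.1 (star q.2.1 * p.2.1) =
      𝔎 q.1 p.1 (star (b * q.2.1) * (b * p.2.1)) + 𝔎 q.1 p.1 (star (d * q.2.1) * (d * p.2.1)) := by
    rw [← map_smul, ← map_add]
    congr 1
    calc ((‖b‖ ^ 2 : ℝ) : ℂ) • (star q.2.1 * p.2.1)
        = star q.2.1 * (((‖b‖ ^ 2 : ℝ) : ℂ) • (1 : B)) * p.2.1 := by simp
      _ = _ := by rw [hd, star_mul, star_mul]; noncomm_ring
  rw [smul_comm _ (l p), smul_comm _ (star (l q)), ← smul_add, ← smul_add, ← add_mul, ← mul_add,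
    ← h, mul_smul_comm, smul_mul_assoc]

/-- The left action of the Kolmogorov decomposition. -/
def kernelOp (b : B) := (exists_kernelOp h𝔎 hstar b).choose

theorem kernelOp_apply (b : B) (p : S × B × C) : kernelOp h𝔎 hstar b (kernelVec h𝔎 hstar p) =
    kernelVec h𝔎 hstar (p.1, b * p.2.1, p.2.2) := (exists_kernelOp h𝔎 hstar b).choose_spec p

/-- The formal generators are not additive in b; additivity appears after separation, as the defect
has length zero. -/
theorem kernelVec_add (σ : S) (b b' : B) (c : C) :
    kernelVec h𝔎 hstar (σ, b + b', c) =
      kernelVec h𝔎 hstar (σ, b, c) + kernelVec h𝔎 hstar (σ, b', c) := by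
  rw [← sub_eq_zero, ← ip_self_eq_zero C]
  simp only [ip_sub_left, ip_sub_right, ip_add_left, ip_add_right, ip_kernelVec, star_add, add_mul,
    mul_add, map_add]
  abel

theorem kernelVec_smul (σ : S) (a : ℂ) (b : B) (c : C) :
    kernelVec h𝔎 hstar (σ, a • b, c) = a • kernelVec h𝔎 hstar (σ, b, c) := by
  rw [← sub_eq_zero, ← ip_self_eq_zero C]
  simp only [ip_sub_left, ip_sub_right, ip_smul_left, ip_smul_right, ip_kernelVec, star_smul,
    smul_mul_assoc, mul_smul_comm, map_smul]
  rw [smul_comm a]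
  simp

/-- The left action of the Kolmogorov decomposition, as a `⋆`-homomorphism. -/
def kernelRep : B →⋆ₙₐ[ℂ] Adjointable C (kernelSemiInner 𝔎 h𝔎 hstar).Hilb where
  toFun b := ⟨kernelOp h𝔎 hstar b, kernelOp h𝔎 hstar (star b), fun x y =>
    (isTotal_kernelVec h𝔎 hstar).ip_ext (S := kernelOp h𝔎 hstar b) (T := .id ℂ _) (S' := .id ℂ _)
      (T' := kernelOp h𝔎 hstar (star b)) (fun p q => by
        simp only [ContinuousLinearMap.id_apply, kernelOp_apply, ip_kernelVec, star_mul,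
          mul_assoc]) x y⟩
  map_smul' a b := Adjointable.ext fun x => congrArg (· x) <|
    (isTotal_kernelVec h𝔎 hstar).clm_ext (T := a • kernelOp h𝔎 hstar b) fun p => by
      simp only [kernelOp_apply, smul_mul_assoc, kernelVec_smul, smul_apply]
  map_zero' := Adjointable.ext fun x => congrArg (· x) <|
    (isTotal_kernelVec h𝔎 hstar).clm_ext (T := 0) fun p => by
      have h := kernelVec_smul h𝔎 hstar p.1 0 0 p.2.2
      simp only [zero_smul] at h
      rw [kernelOp_apply, zero_mul, h, zero_apply]
  map_add' b b' := Adjointable.ext fun x => congrArg (· x) <|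
    (isTotal_kernelVec h𝔎 hstar).clm_ext (T := kernelOp h𝔎 hstar b + kernelOp h𝔎 hstar b')
      fun p => by
        simp only [kernelOp_apply, add_mul, kernelVec_add, add_apply]
  map_mul' b b' := Adjointable.ext fun x => congrArg (· x) <|
    (isTotal_kernelVec h𝔎 hstar).clm_ext (T := (kernelOp h𝔎 hstar b).comp (kernelOp h𝔎 hstar b'))
      fun p => by
        simp only [kernelOp_apply, mul_assoc, ContinuousLinearMap.comp_apply]
  map_star' b := Adjointable.ext fun x => rfl

theorem kernelRep_apply (b : B) (p : S × B × C) : kernelRep h𝔎 hstar b (kernelVec h𝔎 hstar p) =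
    kernelVec h𝔎 hstar (p.1, b * p.2.1, p.2.2) := kernelOp_apply h𝔎 hstar b p

end Dilation

/-! ### Symmetry and covariance of the kernel -/

section KernelFamily

variable {B C D E F S G : Type*} [CStarAlgebra B] [PartialOrder B] [CStarAlgebra C]
  [PartialOrder C] [CStarAlgebra D]
  [NormedAddCommGroup E] [NormedSpace ℂ E] [Module Bᵐᵒᵖ E] [CStarModule Bᵐᵒᵖ E]
  [NormedAddCommGroup F] [NormedSpace ℂ F] [Module Cᵐᵒᵖ F] [CStarModule Cᵐᵒᵖ F]
  {𝔎 : S → S → B →L[ℂ] C} {K : S → E → F}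

/-- The hermitian symmetry required by the Kolmogorov form: on inner products it is that of ⟨K^σ(x),
K^{σ'}(y)⟩, and fullness extends it. -/
theorem IsKernelFamily.star_kernel (hE : IsFull B E) (hK : IsKernelFamily 𝔎 K) (σ σ' : S) (b : B) :
    star (𝔎 σ σ' b) = 𝔎 σ' σ (star b) := by
  refine hE.induction (P := fun b => star (𝔎 σ σ' b) = 𝔎 σ' σ (star b)) ?_
    (isClosed_eq (𝔎 σ σ').continuous.star ((𝔎 σ' σ).continuous.comp continuous_star)) b
  intro b hb
  induction hb using Submodule.span_induction with
  | mem b hb => obtain ⟨x, y, rfl⟩ := hb; rw [← hK, star_ip, star_ip, hK]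
  | zero => simp only [map_zero, star_zero]
  | add b b' _ _ hb hb' => simp only [map_add, star_add, hb, hb']
  | smul c b _ hb => simp only [map_smul, star_smul, hb]

/-- In ⟨K^σ(η_t x), K^{σ'}(η_t y)⟩ covariance produces u'_t twice, which cancels, and leaves u_t and
u_t⋆ outside. -/
theorem IsKernelFamily.kernel_inducedAction [Group G] {η : G →* Aut B E} {u : G →* unitary C}
    {u' : G →* unitary D} {φ : D →⋆ₙₐ[ℂ] Adjointable C F} (hE : IsFull B E)
    (hK : IsKernelFamily 𝔎 K) (hcov : IsCovariant φ u' u η K) (σ σ' : S) (t : G) (b : B) :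
    𝔎 σ σ' (inducedAction η t b) = u t * 𝔎 σ σ' b * star (u t : C) := by
  have h : (𝔎 σ σ').comp (starHomCLM (inducedAction η t)) =
      (ContinuousLinearMap.mulLeftRight ℂ C (u t) (star (u t : C))).comp (𝔎 σ σ') := by
    refine hE.clm_ext fun x y => ?_
    -- The left action φ need not be unital; covariance at t = 1 shows that φ(1) fixes the range of
    -- K.
    have h1 : φ 1 (K σ' y) = K σ' y := by
      have := hcov 1 σ' y
      rw [action_one_apply, map_one, map_one, OneMemClass.coe_one, OneMemClass.coe_one, star_one,
        MulOpposite.op_one, one_smul] at this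
      exact this.symm
    simp only [ContinuousLinearMap.comp_apply, starHomCLM_apply, inducedAction_ip,
      ContinuousLinearMap.mulLeftRight_apply]
    rw [← hK, ← hK, hcov, hcov, ip_op_smul_left, ip_op_smul_right, ip_hom_apply_hom_apply,
      Unitary.coe_star_mul_self, h1, star_star, mul_assoc]
  exact congrArg (· b) h

end KernelFamily

/-! ### Kernels and tensor representations from a covariant correspondence -/

section Covariance

variable {B C D E F S G : Type*} [CStarAlgebra B] [PartialOrder B] [StarOrderedRing B]
  [CStarAlgebra C] [PartialOrder C] [StarOrderedRing C] [CStarAlgebra D]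
  [NormedAddCommGroup E] [NormedSpace ℂ E] [Module Bᵐᵒᵖ E] [CStarModule Bᵐᵒᵖ E]
  [NormedAddCommGroup F] [NormedSpace ℂ F] [Module Cᵐᵒᵖ F] [CStarModule Cᵐᵒᵖ F]
  {X : Type*} [NormedAddCommGroup X] [NormedSpace ℂ X] [Module Cᵐᵒᵖ X] [CStarModule Cᵐᵒᵖ X]
  {π : B →⋆ₙₐ[ℂ] Adjointable C X}

variable (π) in
/-- The kernel `𝔎^{σ,σ'}(b) = ⟨i(σ), b i(σ')⟩`. -/
def vectorKernel (i : S → X) (σ σ' : S) : B →L[ℂ] C :=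
  LinearMap.mkContinuous
    { toFun := fun b => ip C (i σ) (π b (i σ'))
      map_add' := fun b b' => by rw [map_add, Adjointable.add_apply, ip_add_right]
      map_smul' := fun a b => by rw [map_smul, Adjointable.smul_apply, ip_smul_right]; rfl }
    (‖i σ‖ * ‖i σ'‖) fun b => by
      calc ‖ip C (i σ) (π b (i σ'))‖ ≤ ‖i σ‖ * (‖b‖ * ‖i σ'‖) :=
            (norm_ip_le _ _).trans
              (mul_le_mul_of_nonneg_left (norm_hom_apply_le π b _) (norm_nonneg _))
        _ = _ := by ring

omit [PartialOrder B] [StarOrderedRing B] in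
theorem vectorKernel_apply (i : S → X) (σ σ' : S) (b : B) :
    vectorKernel π i σ σ' b = ip C (i σ) (π b (i σ')) := rfl

-- The sum is the squared length of ∑ b_j i(σ_j) c_j.
omit [PartialOrder B] [StarOrderedRing B] in
theorem isCPDKernel_vectorKernel (i : S → X) : IsCPDKernel (vectorKernel π i) := by
  intro n σ b c
  refine (ip_self_nonneg C (∑ j, MulOpposite.op (c j) • π (b j) (i (σ j)))).trans_eq ?_
  simp only [ip_sum_left, ip_sum_right, ip_op_smul_left, ip_op_smul_right, ip_hom_apply_hom_apply,
    vectorKernel_apply, Finset.sum_mul, mul_assoc]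
  exact Finset.sum_comm

theorem isKernelFamily_vectorKernel {i : S → X} {ν : InteriorTensor E π → F}
    (hν : IsIsometry C ν) : IsKernelFamily (vectorKernel π i) fun σ (x : E) => ν (tmul π x (i σ)) :=
  fun σ σ' x x' => by rw [hν, ip_tmul, vectorKernel_apply]

variable [Group G] {η : G →* Aut B E} {v : G →* unitary (Adjointable C X)}

omit [StarOrderedRing B] [StarOrderedRing C] in
theorem hom_inducedAction_apply (hv : ∀ b t, π (inducedAction η t b) =
      (v t : Adjointable C X) * π b * star (v t : Adjointable C X)) (b : B) (t : G) (y : X) :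
    π (inducedAction η t b) ((v t : Adjointable C X) y) = (v t : Adjointable C X) (π b y) := by
  rw [hv, Adjointable.mul_apply, ← Adjointable.mul_apply (star _), Unitary.coe_star_mul_self,
    Adjointable.one_apply, Adjointable.mul_apply]

/-- A covariant representation induces a unitary representation on the interior tensor product. -/
theorem exists_tensorRep [TopologicalSpace G] (hη : IsContinuousAction η)
    (hvc : IsStronglyContinuous v) (hv : ∀ b t, π (inducedAction η t b) =
      (v t : Adjointable C X) * π b * star (v t : Adjointable C X)) :
    ∃ w : G →* unitary (Adjointable C (InteriorTensor E π)), IsStronglyContinuous w ∧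
      ∀ t x y, (w t : Adjointable C (InteriorTensor E π)) (tmul π x y) =
        tmul π ((η t : Equiv.Perm E) x) ((v t : Adjointable C X) y) := by
  have ha := isTotal_tmul (E := E) π
  obtain ⟨w, hw⟩ := ha.exists_unitaryRep
    (fun (t : G) p => ((η t : Equiv.Perm E) p.1, (v t : Adjointable C X) p.2))
    (fun p => by rw [action_one_apply, map_one]; rfl)
    (fun s t p => by rw [action_mul_apply, map_mul]; rfl)
    -- By covariance ⟨v_t y, π(α_t⟨x, x'⟩) v_t y'⟩ = ⟨v_t y, v_t π(⟨x, x'⟩) y'⟩, and v_t drops out.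
    (fun t p q => by
      rw [ip_tmul, ip_tmul, ← inducedAction_ip, hom_inducedAction_apply hv, isIsometry_unitary])
  refine ⟨w, ha.isStronglyContinuous fun p => ?_, fun t x y => hw t (x, y)⟩
  simp only [hw]
  exact continuous_tmul π (hη p.1) (hvc p.2)

theorem isCovariant_of_rep {u : G →* unitary C} {u' : G →* unitary D}
    {φ : D →⋆ₙₐ[ℂ] Adjointable C F} {i : S → X} {ν : InteriorTensor E π → F}
    {w : G →* unitary (Adjointable C (InteriorTensor E π))} (hν : IsIsometry C ν)
    (hv : ∀ b t, π (inducedAction η t b) =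
      (v t : Adjointable C X) * π b * star (v t : Adjointable C X))
    (hi : ∀ t σ, (v t : Adjointable C X) (i σ) = MulOpposite.op (u t : C) • i σ)
    (hw : ∀ (b : B) (c : C) (x : E) (σ : S) (t : G),
      (w t : Adjointable C (InteriorTensor E π)) (tmul π x (MulOpposite.op c • π b (i σ))) =
        tmul π ((η t : Equiv.Perm E) x)
          ((v t : Adjointable C X) (MulOpposite.op c • π b (i σ))))
    (hνw : ∀ t z, ν ((w t : Adjointable C (InteriorTensor E π)) z) = φ (u' t : D) (ν z)) :
    IsCovariant φ u' u η fun σ (x : E) => ν (tmul π x (i σ)) := by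
  intro t σ x
  -- The vector π(1) i(σ) may differ from i(σ), but the unit passes through the tensor sign to x;
  -- the next identity is its analogue after applying v_t.
  have h1 : tmul π x (π 1 (i σ)) = tmul π x (i σ) := by
    rw [tmul_hom_apply, MulOpposite.op_one, one_smul]
  have h2 : tmul π ((η t : Equiv.Perm E) x) ((v t : Adjointable C X) (π 1 (i σ))) =
      tmul π ((η t : Equiv.Perm E) x) ((v t : Adjointable C X) (i σ)) := tmul_eq_tmul fun z => by
    rw [← action_apply_inv_apply η t z, ← inducedAction_ip, hom_inducedAction_apply hv,
      hom_inducedAction_apply hv, ← Adjointable.mul_apply (π _), ← map_mul, mul_one]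
  -- The choice c = u_t⋆ cancels the u_t in v_t i(σ) = i(σ) u_t and leaves η_t x ⊙ i(σ).
  have h3 := hw 1 (star (u t : C)) x σ t
  rw [← op_smul_tmul, Adjointable.map_op_smul, Adjointable.map_op_smul, h1, ← op_smul_tmul, h2, hi,
    op_smul_tmul, ← mul_smul, ← MulOpposite.op_mul, Unitary.mul_star_self_of_mem (u t).2,
    MulOpposite.op_one, one_smul] at h3
  change ν _ = _
  rw [← h3, hν.map_op_smul, hνw]

end Covariance

/-! ### Covariance of the Kolmogorov decomposition -/

section CovariantDilation

variable {B C D E F S G : Type*} [CStarAlgebra B] [PartialOrder B] [StarOrderedRing B]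
  [CStarAlgebra C] [PartialOrder C] [StarOrderedRing C] [CStarAlgebra D]
  [NormedAddCommGroup E] [NormedSpace ℂ E] [Module Bᵐᵒᵖ E] [CStarModule Bᵐᵒᵖ E]
  [NormedAddCommGroup F] [NormedSpace ℂ F] [Module Cᵐᵒᵖ F] [CStarModule Cᵐᵒᵖ F]
  {𝔎 : S → S → B →L[ℂ] C} {K : S → E → F} (h𝔎 : IsCPDKernel 𝔎)
  (hstar : ∀ σ σ' b, star (𝔎 σ σ' b) = 𝔎 σ' σ (star b))

/-- Both Gram kernels equal c⋆ 𝔎^{σ,σ'}(b⋆ ⟨x, x'⟩ b') c', because ⟨x b, x' b'⟩ = b⋆ ⟨x, x'⟩ b'. -/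
theorem exists_kernelIsometry [CompleteSpace F] (hK : IsKernelFamily 𝔎 K) :
    ∃ ν : InteriorTensor E (kernelRep h𝔎 hstar) →L[ℂ] F, IsIsometry C ν ∧
      ∀ x σ b c, ν (tmul _ x (kernelVec h𝔎 hstar (σ, b, c))) =
        MulOpposite.op c • K σ (MulOpposite.op b • x) := by
  obtain ⟨ν, hν, h⟩ := ((isTotal_kernelVec h𝔎 hstar).tmul E (kernelRep h𝔎 hstar)).exists_isometry
    (C := C) (fun p : E × S × B × C =>
      MulOpposite.op p.2.2.2 • K p.2.1 (MulOpposite.op p.2.2.1 • p.1))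
    (fun p q => by
      rw [ip_tmul, kernelRep_apply, ip_kernelVec, ip_op_smul_left, ip_op_smul_right, hK,
        ip_op_smul_left, ip_op_smul_right]
      simp only [mul_assoc])
  exact ⟨ν, hν, fun x σ b c => h (x, σ, b, c)⟩

variable [Group G] {η : G →* Aut B E} {u : G →* unitary C}

/-- The factors u_t and u_t⋆ that `hcov` puts around the kernel cancel against those attached to c
and c', so the Gram kernel is preserved. -/
theorem exists_kernelUnitaryRep [TopologicalSpace G] (hE : IsFull B E)
    (hη : IsContinuousAction η) (hu : Continuous u)
    (hcov : ∀ σ σ' t b, 𝔎 σ σ' (inducedAction η t b) = u t * 𝔎 σ σ' b * star (u t : C)) :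
    ∃ v : G →* unitary (Adjointable C (kernelSemiInner 𝔎 h𝔎 hstar).Hilb),
      IsStronglyContinuous v ∧ ∀ t σ b c,
        (v t : Adjointable C (kernelSemiInner 𝔎 h𝔎 hstar).Hilb) (kernelVec h𝔎 hstar (σ, b, c)) =
          kernelVec h𝔎 hstar (σ, inducedAction η t b, u t * c) := by
  have ha := isTotal_kernelVec h𝔎 hstar
  obtain ⟨v, hv⟩ := ha.exists_unitaryRep
    (fun (t : G) p => (p.1, inducedAction η t p.2.1, u t * p.2.2))
    (fun p => by rw [inducedAction_one_apply hE, map_one, OneMemClass.coe_one, one_mul])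
    (fun s t p => by rw [inducedAction_mul_apply hE, map_mul, Submonoid.coe_mul, mul_assoc])
    (fun t p q => by
      rw [ip_kernelVec, ip_kernelVec]
      dsimp only
      rw [← map_star, ← map_mul, hcov, star_mul]
      have h : star (u t : C) * u t = 1 := Unitary.coe_star_mul_self _
      calc _ = star p.2.2 * (star (u t : C) * u t) * 𝔎 p.1 q.1 (star p.2.1 * q.2.1) *
            (star (u t : C) * u t) * q.2.2 := by simp only [mul_assoc]
        _ = _ := by rw [h, mul_one, mul_one])
  refine ⟨v, ha.isStronglyContinuous fun p => ?_, fun t σ b c => hv t (σ, b, c)⟩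
  simp only [hv]
  -- On generators the Gram kernel in (s, t) is built from the norm-continuous s ↦ u_s and s ↦
  -- α_s(b) and the bounded map 𝔎.
  refine continuous_of_gram C ?_
  simp only [ip_kernelVec]
  have hα := continuous_inducedAction hE hη p.2.1
  have hu' : Continuous fun t => (u t : C) := continuous_subtype_val.comp hu
  exact (((hu'.comp continuous_fst).mul continuous_const).star.mul
    ((𝔎 p.1 p.1).continuous.comp ((hα.comp continuous_fst).star.mul (hα.comp continuous_snd)))).mul
    ((hu'.comp continuous_snd).mul continuous_const)

-- In the form π(α_t(b)) v_t = v_t π(b), the relation on generators is just the multiplicativity of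
-- α_t.
omit [StarOrderedRing B] in
theorem hom_inducedAction_of_kernelVec
    {v : G →* unitary (Adjointable C (kernelSemiInner 𝔎 h𝔎 hstar).Hilb)}
    (hv : ∀ t σ b c,
      (v t : Adjointable C (kernelSemiInner 𝔎 h𝔎 hstar).Hilb) (kernelVec h𝔎 hstar (σ, b, c)) =
        kernelVec h𝔎 hstar (σ, inducedAction η t b, u t * c)) (b : B) (t : G) :
    kernelRep h𝔎 hstar (inducedAction η t b) =
      (v t : Adjointable C (kernelSemiInner 𝔎 h𝔎 hstar).Hilb) * kernelRep h𝔎 hstar b *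
        star (v t : Adjointable C (kernelSemiInner 𝔎 h𝔎 hstar).Hilb) := by
  have h : (homCLM (kernelRep h𝔎 hstar) (inducedAction η t b)).comp
      (isIsometry_unitary (v t)).toCLM =
      (isIsometry_unitary (v t)).toCLM.comp (homCLM (kernelRep h𝔎 hstar) b) :=
    (isTotal_kernelVec h𝔎 hstar).clm_ext fun p => by
      simp only [ContinuousLinearMap.comp_apply, IsIsometry.toCLM_apply, homCLM_apply]
      obtain ⟨σ, b', c⟩ := p
      rw [hv, kernelRep_apply, kernelRep_apply, hv, map_mul]
  have h' : kernelRep h𝔎 hstar (inducedAction η t b) *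
      (v t : Adjointable C (kernelSemiInner 𝔎 h𝔎 hstar).Hilb) =
      (v t : Adjointable C (kernelSemiInner 𝔎 h𝔎 hstar).Hilb) * kernelRep h𝔎 hstar b :=
    Adjointable.ext fun x => congrArg (· x) h
  rw [← h', mul_assoc, Unitary.mul_star_self_of_mem (v t).2, mul_one]

end CovariantDilation

end HilbertModule

end

/-! ### The equivalence -/

theorem mainTheorem3
    {G : Type uG} [Group G] [TopologicalSpace G] [IsTopologicalGroup G] [LocallyCompactSpace G]
    {B : Type uB} [CStarAlgebra B] [PartialOrder B] [StarOrderedRing B]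
    {C : Type uC} [CStarAlgebra C] [PartialOrder C] [StarOrderedRing C]
    {D : Type uD} [CStarAlgebra D]
    (u : G →* unitary C) (hu : Continuous u) (u' : G →* unitary D) (hu' : Continuous u')
    {E : Type uE} [NormedAddCommGroup E] [NormedSpace ℂ E] [Module Bᵐᵒᵖ E] [CStarModule Bᵐᵒᵖ E]
    [CompleteSpace E] (hE : IsFull B E)
    {F : Type uF} [NormedAddCommGroup F] [NormedSpace ℂ F] [Module Cᵐᵒᵖ F] [CStarModule Cᵐᵒᵖ F]
    [CompleteSpace F] (φ : D →⋆ₙₐ[ℂ] Adjointable C F)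
    {S : Type uS} (K : S → E → F)
    (η : G →* Aut B E) (hη : IsContinuousAction η) :
    (∃ 𝔎 : S → S → B →L[ℂ] C,
      IsCPDKernel 𝔎 ∧ IsKernelFamily 𝔎 K ∧ IsCovariant φ u' u η K) ↔
    ∃ (𝓕 : Type (max uB uC uS)) (_ : NormedAddCommGroup 𝓕) (_ : NormedSpace ℂ 𝓕)
      (_ : Module Cᵐᵒᵖ 𝓕) (_ : CStarModule Cᵐᵒᵖ 𝓕) (_ : CompleteSpace 𝓕)
      (π : B →⋆ₙₐ[ℂ] Adjointable C 𝓕) (i : S → 𝓕) (ν : InteriorTensor E π → F)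
      (v : G →* unitary (Adjointable C 𝓕))
      (w' : G →* unitary (Adjointable C (InteriorTensor E π))),
      IsIsometry C ν ∧
      (∀ (x : E) (σ : S), ν (tmul π x (i σ)) = K σ x) ∧
      IsStronglyContinuous v ∧
      IsStronglyContinuous w' ∧
      (∀ (b : B) (t : G), π (inducedAction η t b) =
        (v t : Adjointable C 𝓕) * π b * star (v t : Adjointable C 𝓕)) ∧
      (∀ (t : G) (σ : S), (v t : Adjointable C 𝓕) (i σ) = MulOpposite.op (u t : C) • i σ) ∧
      (∀ (b : B) (c : C) (x : E) (σ : S) (t : G),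
        (w' t : Adjointable C (InteriorTensor E π))
            (tmul π x (MulOpposite.op c • π b (i σ))) =
          tmul π ((η t : Equiv.Perm E) x)
            ((v t : Adjointable C 𝓕) (MulOpposite.op c • π b (i σ)))) ∧
      (∀ (t : G) (z : InteriorTensor E π),
        ν ((w' t : Adjointable C (InteriorTensor E π)) z) = φ (u' t : D) (ν z)) := by
  constructor
  · rintro ⟨𝔎, h𝔎, hK, hcov⟩
    have hstar := hK.star_kernel hE
    obtain ⟨ν, hν, hνK⟩ := exists_kernelIsometry h𝔎 hstar hK
    obtain ⟨v, hvc, hv⟩ := exists_kernelUnitaryRep h𝔎 hstar hE hη hu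
      (hK.kernel_inducedAction hE hcov)
    have hvπ : ∀ (b : B) (t : G), kernelRep h𝔎 hstar (inducedAction η t b) =
        (v t : Adjointable C _) * kernelRep h𝔎 hstar b * star (v t : Adjointable C _) :=
      fun b t => hom_inducedAction_of_kernelVec h𝔎 hstar hv b t
    obtain ⟨w, hwc, hw⟩ := exists_tensorRep hη hvc hvπ
    refine ⟨_, _, _, _, _, inferInstance, kernelRep h𝔎 hstar,
      fun σ => kernelVec h𝔎 hstar (σ, 1, 1), ν, v, w, hν, fun x σ => ?_, hvc, hwc, hvπ,
      fun t σ => ?_, fun b c x σ t => hw _ _ _, fun t z => ?_⟩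
    · rw [hνK, MulOpposite.op_one, one_smul, MulOpposite.op_one, one_smul]
    · rw [hv, inducedAction_apply_one hE, op_smul_kernelVec, mul_one, one_mul]
    -- On x ⊙ b i(σ) c this reads K^σ(η_t(x) α_t(b)) u_t c = u'_t K^σ(x b) c, which is covariance at
    -- η_t(x b) = η_t(x) α_t(b).
    · have h : ν.comp (isIsometry_unitary (w t)).toCLM = (homCLM φ (u' t)).comp ν := by
        refine ((isTotal_kernelVec h𝔎 hstar).tmul E (kernelRep h𝔎 hstar)).clm_ext ?_
        rintro ⟨x, σ, b, c⟩
        simp only [ContinuousLinearMap.comp_apply, IsIsometry.toCLM_apply, homCLM_apply]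
        rw [hw, hv, hνK, hνK, ← action_op_smul, hcov, ← mul_smul, ← MulOpposite.op_mul,
          ← mul_assoc, Unitary.star_mul_self_of_mem (u t).2, one_mul, Adjointable.map_op_smul]
      exact congrArg (· z) h
  · rintro ⟨𝓕, _, _, _, _, _, π, i, ν, v, w, hν, hνK, -, -, hv, hi, hw, hνw⟩
    obtain rfl : (fun σ x => ν (tmul π x (i σ))) = K := funext fun σ => funext fun x => hνK x σ
    exact ⟨vectorKernel π i, isCPDKernel_vectorKernel i, isKernelFamily_vectorKernel hν,
      isCovariant_of_rep hν hv hi hw hνw⟩
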